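/- Let $\tilde M$ be a complex manifold of complex dimension $n+k$ and let $M\subset\tilde M$ be a generic $CR$ submanifold of type $(n,k)$, i.e. near each of its points $M=\{\rho_1=\cdots=\rho_k=0\}$ with smooth real functions $\rho_j$ such that $\partial\rho_1\wedge\cdots\wedge\partial\rho_k\neq 0$. Write $J$ for the complex structure of $\tilde M$, $H_xM=T_xM\cap JT_xM$ and $d^c=(\partial-\bar\partial)/i$. Let $H^0M\subset T^*\tilde M|_M$ be the characteristic bundle, whose fibre at $x\in M$ is $H^0_xM=\{\xi\in T^*_x\tilde M : \xi(Jv)=0\ \text{for all } v\in T_xM\}=\{\sum_j\lambda^j d^c\rho_j(x):\lambda^j\in\mathbb R\}$ (by restriction to $T_xM$ it is identified with the annihilator of $H_xM$ in $T_x^*M$), and let $\dot H^0M$ be the set of its nonzero covectors. For $\xi\in H^0_xM$ the Levi form $\mathcal L_\xi$ is the Hermitian form on $H_xM$ given by $\mathcal L_\xi(X)=d\tilde\xi(X,JX)$, where $\tilde\xi$ is any smooth section of $H^0M$ with $\tilde\xi(x)=\xi$. Let $\vartheta$ be the tautological one-form on $H^0M$, $\vartheta_\xi(X)=\xi(\pi_*X)$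 with $\pi:H^0M\to M$ the projection, and set $$H_\xi H^0M=\{X\in T_\xi H^0M : \vartheta(X)=0,\ d\vartheta(X,Y)=0\ \text{for all } Y\in T_\xi H^0M\}.$$ A point $\xi_0\in\dot H^0M$ is called regular if there is a smooth submanifold $V$ of an open neighborhood of $\xi_0$ in $\dot H^0M$ with $\xi_0\in V$, $T_\xi V\subset H_\xi H^0M$ for all $\xi\in V$, and $T_{\xi_0}V=H_{\xi_0}H^0M$. **Theorem.** Let $x_0\in M$, let $\xi_0\in\dot H^0_{x_0}M$ be a regular point, and let $m$ be the rank of the Levi form $\mathcal L_{\xi_0}$. Then there exist an open neighborhood $\tilde\omega$ of $x_0$ in $\tilde M$, contained in the domain of a holomorphic chart of $\tilde M$, an $(n-m)$-dimensional complex submanifold $W$ of $\tilde\omega$ with $x_0\in W\subset M\cap\tilde\omega$, and a smooth function $\rho:\tilde\omega\to\mathbb R$ with $\rho=0$ on $M\cap\tilde\omega$ and $d^c\rho(x_0)=\xi_0$, such that for all holomorphic coordinates $z^1,\dots,z^{n+k}$ on an open subset of $\tilde M$, the restrictions to $W$ of the functions $\partial\rho/\partial z^\alpha$, $\alpha=1,\dots,n+k$,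 are holomorphic (where the coordinates are defined). -/

import Mathlib

open Set Filter Topology Manifold
open scoped ContDiff

namespace CRGeom

noncomputable section

section Forms

variable {E : Type*} [NormedAddCommGroup E] [NormedSpace ℂ E]

/-- The `(1,0)`-part `v ↦ (ℓ(v) - i ℓ(iv)) / 2` of a real covector `ℓ` on a complex vector space.
For `ℓ = dρ` this is `∂ρ`. -/
def part10 (l : E →L[ℝ] ℝ) (v : E) : ℂ :=
  ((l v : ℂ) - Complex.I * (l (Complex.I • v) : ℂ)) / 2

/-- The `(0,1)`-part `v ↦ (ℓ(v) + i ℓ(iv)) / 2` of a real covector `ℓ`.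
For `ℓ = dρ` this is `∂̄ρ`. -/
def part01 (l : E →L[ℝ] ℝ) (v : E) : ℂ :=
  ((l v : ℂ) + Complex.I * (l (Complex.I • v) : ℂ)) / 2

/-- `(∂ - ∂̄) / i` applied to a real covector `ℓ`. For `ℓ = dρ` this is `d^c ρ`. -/
def dc (l : E →L[ℝ] ℝ) (v : E) : ℂ := (part10 l v - part01 l v) / Complex.I

/-- `d^c ρ` is the real covector `v ↦ -dρ(iv)`. -/
theorem dc_eq (l : E →L[ℝ] ℝ) (v : E) : dc l v = ((-(l (Complex.I • v)) : ℝ) : ℂ) := by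
  unfold dc part10 part01
  field_simp
  push_cast
  ring

end Forms

section Submanifolds

/-- `W` is a `d`-dimensional (embedded) `𝕜`-submanifold of the `𝕜`-manifold `X`: around each of its
points there is a chart of the `C^∞` structure of `X` in which `W` is a `d`-dimensional linear slice.
For `𝕜 = ℂ` this is a complex submanifold (`C^∞` over `ℂ` means holomorphic), for `𝕜 = ℝ` a smooth
real submanifold. -/
def IsSubmanifold (𝕜 : Type*) [NontriviallyNormedField 𝕜] (E : Type*) [NormedAddCommGroup E]
    [NormedSpace 𝕜 E] {X : Type*} [TopologicalSpace X] [ChartedSpace E X]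
    (d : ℕ) (W : Set X) : Prop :=
  ∀ p ∈ W, ∃ φ ∈ IsManifold.maximalAtlas 𝓘(𝕜, E) ∞ X, p ∈ φ.source ∧
    ∃ L : Submodule 𝕜 E, Module.finrank 𝕜 L = d ∧ ∀ q ∈ φ.source, (q ∈ W ↔ φ q ∈ L)

/-- The tangent space at `x` of a subset `S` of a real normed space: the span of the velocities at
`x` of the smooth curves in `S` through `x`. When `S` is a submanifold these velocities
already form a linear subspace. -/
def tangent {F : Type*} [NormedAddCommGroup F] [NormedSpace ℝ F] (S : Set F) (x : F) :
    Submodule ℝ F :=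
  Submodule.span ℝ {v | ∃ γ : ℝ → F, ContDiffAt ℝ ∞ γ 0 ∧ γ 0 = x ∧ HasDerivAt γ v 0 ∧
    ∀ᶠ t in 𝓝 (0 : ℝ), γ t ∈ S}

end Submanifolds

section Local

variable {E : Type*} [NormedAddCommGroup E] [NormedSpace ℂ E]

/-- The holomorphic tangent space `H_x S = T_x S ∩ i T_x S`. -/
def holTangent (S : Set E) (x : E) : Submodule ℂ E where
  carrier := {v | v ∈ tangent S x ∧ Complex.I • v ∈ tangent S x}
  zero_mem' := by simp
  add_mem' := by
    rintro a b ⟨h1, h2⟩ ⟨h3, h4⟩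
    exact ⟨add_mem h1 h3, by rw [smul_add]; exact add_mem h2 h4⟩
  smul_mem' := by
    rintro c v ⟨h1, h2⟩
    have key : ∀ w : E, c • w = c.re • w + c.im • (Complex.I • w) := by
      intro w
      conv_lhs => rw [← Complex.re_add_im c]
      rw [add_smul, mul_smul, Complex.coe_smul, Complex.coe_smul]
    refine ⟨?_, ?_⟩
    · rw [key]
      exact add_mem (Submodule.smul_mem _ _ h1) (Submodule.smul_mem _ _ h2)
    · rw [smul_comm, key, ← mul_smul Complex.I Complex.I, Complex.I_mul_I, neg_one_smul]
      exact add_mem (Submodule.smul_mem _ _ h2)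
        (Submodule.smul_mem _ _ (Submodule.neg_mem _ h1))

/-- The characteristic bundle `H⁰S` of a generic `CR` submanifold `S` of an open subset of `E`, as a
subset of the (real) cotangent bundle `T*E = E × E*`. Its fibre at `x ∈ S` is the image of the
conormal space of `S` under the transpose of the complex structure; in terms of defining functions,
it consists of the covectors `∑ λʲ d^c ρ_j(x)`. Restriction of covectors to `T_x S` identifies it
with the annihilator of `H_x S` in `T*_x S`. -/
def charBundle (S : Set E) : Set (E × (E →L[ℝ] ℝ)) :=
  {p | p.1 ∈ S ∧ ∀ v ∈ tangent S p.1, p.2 (Complex.I • v) = 0}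

/-- The nonzero covectors in the characteristic bundle. -/
def dotCharBundle (S : Set E) : Set (E × (E →L[ℝ] ℝ)) :=
  {p | p ∈ charBundle S ∧ p.2 ≠ 0}

/-- The tautological one-form `ϑ_(x,ξ)(X) = ξ(π_* X)` on `T*E = E × E*`. -/
def taut (p : E × (E →L[ℝ] ℝ)) : (E × (E →L[ℝ] ℝ)) →L[ℝ] ℝ :=
  p.2.comp (ContinuousLinearMap.fst ℝ E (E →L[ℝ] ℝ))

/-- The exterior derivative `dα_x(u,w) = (D_u α)(w) - (D_w α)(u)` of a one-form `α`. -/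
def extD {F : Type*} [NormedAddCommGroup F] [NormedSpace ℝ F] (α : F → F →L[ℝ] ℝ) (x u w : F) : ℝ :=
  fderiv ℝ α x u w - fderiv ℝ α x w u

theorem extD_add_left {F : Type*} [NormedAddCommGroup F] [NormedSpace ℝ F] (α : F → F →L[ℝ] ℝ)
    (x u v w : F) : extD α x (u + v) w = extD α x u w + extD α x v w := by
  simp only [extD, map_add, add_apply]
  ring

theorem extD_smul_left {F : Type*} [NormedAddCommGroup F] [NormedSpace ℝ F] (α : F → F →L[ℝ] ℝ)
    (x : F) (c : ℝ) (u w : F) : extD α x (c • u) w = c * extD α x u w := by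
  simp only [extD, map_smul, smul_apply, smul_eq_mul]
  ring

/-- `N_ξ H⁰S = {X ∈ T_ξ H⁰S | ϑ(X) = 0}`. -/
def charN (S : Set E) (p : E × (E →L[ℝ] ℝ)) : Submodule ℝ (E × (E →L[ℝ] ℝ)) :=
  tangent (charBundle S) p ⊓ LinearMap.ker (taut p : (E × (E →L[ℝ] ℝ)) →ₗ[ℝ] ℝ)

/-- `H_ξ H⁰S = {X ∈ N_ξ H⁰S | dϑ(X,Y) = 0 for all Y ∈ T_ξ H⁰S}`. -/
def charH (S : Set E) (p : E × (E →L[ℝ] ℝ)) : Submodule ℝ (E × (E →L[ℝ] ℝ)) where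
  carrier := {X | X ∈ charN S p ∧ ∀ Y ∈ tangent (charBundle S) p, extD taut p X Y = 0}
  zero_mem' := ⟨zero_mem _, fun Y _ => by simp [extD]⟩
  add_mem' := by
    rintro a b ⟨h1, h2⟩ ⟨h3, h4⟩
    exact ⟨add_mem h1 h3, fun Y hY => by rw [extD_add_left, h2 Y hY, h4 Y hY, add_zero]⟩
  smul_mem' := by
    rintro c a ⟨h1, h2⟩
    exact ⟨Submodule.smul_mem _ _ h1, fun Y hY => by rw [extD_smul_left, h2 Y hY, mul_zero]⟩

/-- `p ∈ Ḣ⁰S` is a regular point: there is a smooth submanifold `V` of `Ḣ⁰S` through `p` with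
`T_ξ V ⊆ H_ξ H⁰S` for all `ξ ∈ V` and `T_p V = H_p H⁰S`. -/
def IsRegularAt (S : Set E) (p : E × (E →L[ℝ] ℝ)) : Prop :=
  ∃ (d : ℕ) (V : Set (E × (E →L[ℝ] ℝ))),
    IsSubmanifold ℝ (E × (E →L[ℝ] ℝ)) d V ∧ p ∈ V ∧ V ⊆ dotCharBundle S ∧
    (∀ q ∈ V, tangent V q ≤ charH S q) ∧ tangent V p = charH S p

/-- `σ` is a smooth section near `x` of the characteristic bundle of `S` with value `ξ` at `x`. -/
def IsCharSection (S : Set E) (x : E) (ξ : E →L[ℝ] ℝ) (σ : E → E →L[ℝ] ℝ) : Prop :=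
  ContDiffAt ℝ ∞ σ x ∧ σ x = ξ ∧ ∀ᶠ y in 𝓝 x, y ∈ S → (y, σ y) ∈ charBundle S

/-- The Hermitian form `h` on `H_x S` with `h(u,u) = dσ(u, iu)`, for a one-form `σ`. When `σ` is a
section of the characteristic bundle extending `ξ`, this is the Levi form at `ξ`. -/
def leviForm (σ : E → E →L[ℝ] ℝ) (x u w : E) : ℂ :=
  (extD σ x u (Complex.I • w) : ℂ) + Complex.I * (extD σ x u w : ℂ)

/-- The Levi form of `S` at `ξ ∈ H⁰_x S` has rank `m`, where `n` is the complex dimension of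
`H_x S`: the Gram matrix of the Levi form in some complex basis of `H_x S` has rank `m`.
The choices of the section and of the basis are immaterial. -/
def HasLeviRank (n : ℕ) (S : Set E) (x : E) (ξ : E →L[ℝ] ℝ) (m : ℕ) : Prop :=
  ∃ σ : E → E →L[ℝ] ℝ, IsCharSection S x ξ σ ∧
    ∃ b : Module.Basis (Fin n) ℂ (holTangent S x),
      (Matrix.of fun i j : Fin n => leviForm σ x (b i : E) (b j : E)).rank = m

end Local

section Global

variable {E : Type*} [NormedAddCommGroup E] [NormedSpace ℂ E]
  {X : Type*} [TopologicalSpace X] [ChartedSpace E X]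

/-- The real cotangent space `T*_x X` of the complex manifold `X` modelled on `E`. -/
abbrev Cotangent (E : Type*) [NormedAddCommGroup E] [NormedSpace ℂ E]
    {X : Type*} [TopologicalSpace X] [ChartedSpace E X] (x : X) : Type _ :=
  TangentSpace 𝓘(ℝ, E) x →L[ℝ] ℝ

/-- `ρ` is a smooth real function on the open set `U` of the complex manifold `X`. -/
def SmoothOn (E : Type*) [NormedAddCommGroup E] [NormedSpace ℂ E]
    {X : Type*} [TopologicalSpace X] [ChartedSpace E X] (ρ : X → ℝ) (U : Set X) : Prop :=
  ContMDiffOn 𝓘(ℝ, E) 𝓘(ℝ, ℝ) ∞ ρ U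

/-- The differential `dρ(x) ∈ T*_x X` of a real function. -/
def dR (E : Type*) [NormedAddCommGroup E] [NormedSpace ℂ E]
    {X : Type*} [TopologicalSpace X] [ChartedSpace E X] (ρ : X → ℝ) (x : X) : Cotangent E x :=
  mfderiv 𝓘(ℝ, E) 𝓘(ℝ, ℝ) ρ x

/-- `M` is a generic `CR` submanifold, of real codimension `k`, of the complex manifold `X`: locally
`M = {ρ₁ = ⋯ = ρ_k = 0}` with smooth real functions such that `∂ρ₁ ∧ ⋯ ∧ ∂ρ_k ≠ 0`. If `X` has
complex dimension `n + k`, then `M` is a `CR` manifold of type `(n, k)`. -/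
def IsGenericCR (E : Type*) [NormedAddCommGroup E] [NormedSpace ℂ E]
    {X : Type*} [TopologicalSpace X] [ChartedSpace E X] (k : ℕ) (M : Set X) : Prop :=
  ∀ x ∈ M, ∃ U : Set X, IsOpen U ∧ x ∈ U ∧ ∃ ρ : Fin k → X → ℝ,
    (∀ j, SmoothOn E (ρ j) U) ∧
    (∀ z ∈ U, (z ∈ M ↔ ∀ j, ρ j z = 0)) ∧
    (∀ z ∈ U, LinearIndependent ℂ (fun j => (part10 (E := E) (dR E (ρ j) z) : E → ℂ)))

/-- The image of `M` in the preferred holomorphic chart at `x`. -/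
def chartImage (E : Type*) [NormedAddCommGroup E]
    {X : Type*} [TopologicalSpace X] [ChartedSpace E X] (M : Set X) (x : X) : Set E :=
  chartAt E x '' (M ∩ (chartAt E x).source)

/-- `ξ ∈ T*_x X` is a regular point of the characteristic bundle `Ḣ⁰M`. The notion is local near
`ξ` and invariant under holomorphic changes of coordinates, so it is read in the coordinates
`T*X = E × E*` given by the preferred chart at `x`; that chart identifies `T_x X` with `E`. -/
def IsRegularPoint (M : Set X) (x : X) (ξ : Cotangent E x) : Prop :=
  IsRegularAt (E := E) (chartImage E M x) (chartAt E x x, ξ)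

/-- The Levi form `L_ξ` of `M` at `ξ ∈ H⁰_x M` has rank `m` (and `H_x M` has complex dimension `n`),
read in the preferred chart at `x`. -/
def LeviRankEq (n : ℕ) (M : Set X) (x : X) (ξ : Cotangent E x) (m : ℕ) : Prop :=
  HasLeviRank (E := E) n (chartImage E M x) (chartAt E x x) ξ m

/-- `d^c ρ(x) = ξ` in `T*_x X`. -/
def DcEq (ρ : X → ℝ) (x : X) (ξ : Cotangent E x) : Prop :=
  ∀ v : TangentSpace 𝓘(ℝ, E) x, dc (E := E) (dR E ρ x) v = ((ξ v : ℝ) : ℂ)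

/-- `f` is holomorphic on the complex submanifold `W` of `X`: locally it is the restriction to `W`
of a holomorphic function on an open subset of `X`. -/
def HolomorphicAlong (E : Type*) [NormedAddCommGroup E] [NormedSpace ℂ E]
    {X : Type*} [TopologicalSpace X] [ChartedSpace E X] (f : X → ℂ) (W : Set X) : Prop :=
  ∀ p ∈ W, ∃ O : Set X, IsOpen O ∧ p ∈ O ∧ ∃ g : X → ℂ,
    MDifferentiableOn 𝓘(ℂ, E) 𝓘(ℂ, ℂ) g O ∧ ∀ q ∈ W ∩ O, g q = f q

/-- For a holomorphic chart `φ` and a vector `e`, the derivative `∂ρ(e)` of a real function `ρ` at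
the point `p`, computed in the chart. For `E = ℂ^N`, `φ = (z¹, …, z^N)` and `e` the `α`-th standard
basis vector this is the Wirtinger derivative `∂ρ/∂z^α`. -/
def dz (φ : OpenPartialHomeomorph X E) (ρ : X → ℝ) (e : E) (p : X) : ℂ :=
  part10 (fderiv ℝ (ρ ∘ φ.symm) (φ p)) e

end Global

end

end CRGeom

/-!
The characteristic bundle `H⁰S` of a generic `CR` submanifold `S ⊆ E` is, up to the complex
structure, its conormal bundle. Identify a real covector with the `(1,0)`-form whose imaginary part
it is, so that `T*E` becomes a complex symplectic manifold. Then `H⁰S` is Lagrangian for the real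
part of the symplectic form (`IsGenericDefining.lagrangian`, which is the symmetry of second
derivatives), while `dϑ` is the imaginary part. Hence `H_ξ H⁰S` is contained in the complex subspace
`charAnn` of vectors annihilated by `T_ξ H⁰S` under the whole complex symplectic form.

At the regular point `ξ₀`, a vector of `charAnn` is determined by its projection to `E`
(`eq_zero_of_mem_charAnn`), and `H_ξ₀ H⁰S` projects onto the kernel of the Levi form, a complex
subspace `H` of dimension `n - m` (`exists_mem_charH_of_mem_leviKer`, `finrank_leviKer`). So the
given integral submanifold `V` is a graph over an open subset of `H`, parametrized by `(γ, ζ)`. For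
`u ∈ H` the vector `D(γ, ζ)(iu) - i D(γ, ζ)(u)` lies in `charAnn` and projects to zero in `H`. At
`ξ₀` such vectors vanish, and by compactness they vanish at nearby points too
(`eventually_charAnn_disjoint`). Therefore `γ` and `ζ` are holomorphic
(`exists_holomorphic_lift`, `contDiffOn_complex_of_real`).

The submanifold `W` is the image of `γ`, straightened by a holomorphic shear. Writing
`ζ = ∑ λ_j d^c ρ_j` with smooth `λ_j` on `H`, and extending the `λ_j` to `E` by means of a
projection onto `H`, the function `ρ = ∑ λ_j ρ_j` satisfies `d^c ρ = ζ` on `W`; that is, `∂ρ` is the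
holomorphic form corresponding to `ζ` (`exists_normalForm`). Holomorphic changes of coordinates
preserve this conclusion (`holomorphicAlong_dz`).
-/

namespace CRGeom

noncomputable section

universe u

/-! ### Complex linear parts and the Cauchy–Riemann equations -/

section HolomorphicPart

variable {E F : Type*} [NormedAddCommGroup E] [NormedSpace ℂ E] [NormedAddCommGroup F]
  [NormedSpace ℂ F]

theorem holPartAux_bound (A : E →L[ℝ] F) (v : E) :
    ‖(1 / 2 : ℂ) • (A v - Complex.I • A (Complex.I • v))‖ ≤ ‖A‖ * ‖v‖ := by
  have h1 : ‖A (Complex.I • v)‖ ≤ ‖A‖ * ‖v‖ := by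
    simpa [norm_smul] using A.le_opNorm (Complex.I • v)
  have h2 : ‖A v - Complex.I • A (Complex.I • v)‖ ≤ ‖A v‖ + ‖A (Complex.I • v)‖ := by
    simpa [norm_smul] using norm_sub_le (A v) (Complex.I • A (Complex.I • v))
  have h3 := A.le_opNorm v
  rw [norm_smul]
  norm_num
  linarith

/-- The complex linear part `v ↦ (A(v) - i A(iv)) / 2` of a real linear map `A` between complex
normed spaces. -/
def holPartAux (A : E →L[ℝ] F) : E →L[ℂ] F :=
  LinearMap.mkContinuous
    { toFun := fun v => (1 / 2 : ℂ) • (A v - Complex.I • A (Complex.I • v))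
      map_add' := fun v w => by simp only [smul_add, map_add]; module
      map_smul' := fun c v => by
        have key : ∀ w : E,
            A (c • w) = (c.re : ℂ) • A w + (c.im : ℂ) • A (Complex.I • w) := by
          intro w
          conv_lhs => rw [← Complex.re_add_im c]
          rw [add_smul, mul_smul, Complex.coe_smul, Complex.coe_smul, map_add, map_smul,
            map_smul, Complex.coe_smul, Complex.coe_smul]
        rw [RingHom.id_apply, smul_comm Complex.I c v, key, key, ← mul_smul Complex.I
          Complex.I v, Complex.I_mul_I, neg_one_smul, map_neg]
        conv_rhs => rw [← Complex.re_add_im c]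
        match_scalars
        · ring
        · linear_combination (c.im / 2 : ℂ) * Complex.I_sq }
    ‖A‖ (holPartAux_bound A)

theorem holPartAux_apply (A : E →L[ℝ] F) (v : E) :
    holPartAux A v = (1 / 2 : ℂ) • (A v - Complex.I • A (Complex.I • v)) := rfl

/-- Taking the complex linear part, as a continuous real linear map. -/
def holPart : (E →L[ℝ] F) →L[ℝ] (E →L[ℂ] F) :=
  LinearMap.mkContinuous
    { toFun := holPartAux
      map_add' := fun A B => by
        ext v
        simp only [holPartAux_apply, add_apply]
        module
      map_smul' := fun c A => by
        ext v
        simp only [holPartAux_apply, smul_apply, RingHom.id_apply, smul_sub, smul_comm c] }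
    1 (fun A => by
      rw [one_mul]
      exact (holPartAux A).opNorm_le_bound (norm_nonneg _) (holPartAux_bound A))

theorem holPart_apply (A : E →L[ℝ] F) (v : E) :
    holPart A v = (1 / 2 : ℂ) • (A v - Complex.I • A (Complex.I • v)) := rfl

theorem holPart_eq_self {A : E →L[ℝ] F} (hA : ∀ v, A (Complex.I • v) = Complex.I • A v) (v : E) :
    holPart A v = A v := by
  rw [holPart_apply, hA, ← mul_smul Complex.I Complex.I, Complex.I_mul_I]
  module

/-- A real differentiable map whose real derivative commutes with `i` is complex differentiable. -/
theorem hasFDerivAt_holPart {f : E → F} {x : E} (hf : DifferentiableAt ℝ f x)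
    (hI : ∀ v, fderiv ℝ f x (Complex.I • v) = Complex.I • fderiv ℝ f x v) :
    HasFDerivAt f (holPart (fderiv ℝ f x)) x :=
  hasFDerivAt_of_restrictScalars ℝ hf.hasFDerivAt (by ext v; exact holPart_eq_self hI v)

/-- A smooth map on an open set whose real derivatives commute with `i` is smooth over `ℂ`: by
symmetry of the second derivative, its complex derivative has the same property. -/
theorem contDiffOn_complex_of_real {E F : Type u} [NormedAddCommGroup E] [NormedSpace ℂ E]
    [NormedAddCommGroup F] [NormedSpace ℂ F] {f : E → F} {U : Set E} (hU : IsOpen U)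
    (hf : ContDiffOn ℝ ∞ f U)
    (hI : ∀ x ∈ U, ∀ v, fderiv ℝ f x (Complex.I • v) = Complex.I • fderiv ℝ f x v) :
    ContDiffOn ℂ ∞ f U := by
  rw [contDiffOn_infty]
  intro n
  induction n generalizing F with
  | zero => exact contDiffOn_zero.2 hf.continuousOn
  | succ n ih =>
    have hder : ∀ x ∈ U, HasFDerivAt f (holPart (fderiv ℝ f x)) x := fun x hx =>
      hasFDerivAt_holPart ((hf.contDiffAt (hU.mem_nhds hx)).differentiableAt (by simp)) (hI x hx)
    have h2 : ContDiffOn ℝ ∞ (fderiv ℝ f) U :=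
      ((contDiffOn_infty_iff_fderiv_of_isOpen hU).1 hf).2
    push_cast
    rw [contDiffOn_succ_iff_fderiv_of_isOpen hU]
    refine ⟨fun x hx => (hder x hx).differentiableAt.differentiableWithinAt,
      fun h => by simp at h, ?_⟩
    refine ContDiffOn.congr (f := fun x => holPart (fderiv ℝ f x)) ?_
      (fun x hx => (hder x hx).fderiv)
    refine ih ((holPart (E := E) (F := F)).contDiff.comp_contDiffOn h2) (fun x hx v => ?_)
    have hd : DifferentiableAt ℝ (fderiv ℝ f) x :=
      (h2.contDiffAt (hU.mem_nhds hx)).differentiableAt (by simp)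
    have hsymm : IsSymmSndFDerivAt ℝ f x :=
      (hf.contDiffAt (hU.mem_nhds hx)).isSymmSndFDerivAt (by
        simp only [minSmoothness_of_isRCLikeNormedField]
        exact WithTop.coe_le_coe.2 (le_top : (2 : ℕ∞) ≤ ⊤))
    have hcomm : ∀ w v : E, fderiv ℝ (fderiv ℝ f) x w (Complex.I • v) =
        Complex.I • fderiv ℝ (fderiv ℝ f) x w v := by
      intro w v
      have e1 : HasFDerivAt (fun y => fderiv ℝ f y (Complex.I • v))
          ((fderiv ℝ (fderiv ℝ f) x).flip (Complex.I • v)) x := by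
        simpa using hd.hasFDerivAt.clm_apply (hasFDerivAt_const (Complex.I • v) x)
      have e2 : HasFDerivAt (fun y => Complex.I • fderiv ℝ f y v)
          (Complex.I • (fderiv ℝ (fderiv ℝ f) x).flip v) x := by
        have := (hd.hasFDerivAt.clm_apply (hasFDerivAt_const v x)).const_smul Complex.I
        simp only [ContinuousLinearMap.comp_zero, zero_add] at this
        exact this
      have e3 : (fun y => Complex.I • fderiv ℝ f y v) =ᶠ[𝓝 x]
          fun y => fderiv ℝ f y (Complex.I • v) := by
        filter_upwards [hU.mem_nhds hx] with y hy using (hI y hy v).symm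
      have := (e1.unique (e2.congr_of_eventuallyEq e3.symm))
      simpa using congrArg (fun T : E →L[ℝ] F => T w) this
    have hfd : fderiv ℝ (fun x => holPart (fderiv ℝ f x)) x =
        (holPart : (E →L[ℝ] F) →L[ℝ] _).comp (fderiv ℝ (fderiv ℝ f) x) :=
      ((holPart (E := E) (F := F)).hasFDerivAt.comp x hd.hasFDerivAt).fderiv
    rw [hfd]
    ext w
    simp only [ContinuousLinearMap.comp_apply, smul_apply, holPart_apply]
    rw [hsymm (Complex.I • v) w, hsymm (Complex.I • v) (Complex.I • w), hcomm, hcomm,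
      hsymm v w, hsymm v (Complex.I • w)]
    module

end HolomorphicPart

/-! ### Smooth families of linear maps and the inverse function theorem -/

section RealAnalysis

variable {E A B : Type*} [NormedAddCommGroup E] [NormedSpace ℝ E] [NormedAddCommGroup A]
  [NormedSpace ℝ A] [NormedAddCommGroup B] [NormedSpace ℝ B] [FiniteDimensional ℝ A]

/-- A family of linear endomorphisms that is smooth and equal to the identity at a point has a
smooth inverse nearby. -/
theorem eventually_contDiffAt_ringInverse {T : E → A →L[ℝ] A} {x : E}
    (hT : ∀ᶠ y in 𝓝 x, ContDiffAt ℝ ∞ T y) (hx : T x = 1) :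
    ∀ᶠ y in 𝓝 x, ContDiffAt ℝ ∞ (fun y => Ring.inverse (T y)) y ∧ IsUnit (T y) := by
  have hu : ∀ᶠ y in 𝓝 x, IsUnit (T y) :=
    hT.self_of_nhds.continuousAt.eventually
      (Units.isOpen.mem_nhds (by rw [hx]; exact isUnit_one))
  filter_upwards [hT, hu] with y hy hyu
  obtain ⟨t, ht⟩ := hyu
  refine ⟨?_, t, ht⟩
  exact ContDiffAt.comp y (g := Ring.inverse) (ht ▸ contDiffAt_ringInverse ℝ t) hy

/-- A smooth family of linear maps that is injective at a point has a smooth family of left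
inverses nearby. -/
theorem exists_smooth_leftInverse [FiniteDimensional ℝ B] {D : E → A →L[ℝ] B} {x : E}
    (hD : ∀ᶠ y in 𝓝 x, ContDiffAt ℝ ∞ D y) (hinj : Function.Injective (D x)) :
    ∃ c : E → B →L[ℝ] A, ∀ᶠ y in 𝓝 x, ContDiffAt ℝ ∞ c y ∧ ∀ a, c y (D y a) = a := by
  obtain ⟨l, hl⟩ := (D x : A →ₗ[ℝ] B).exists_leftInverse_of_injective
    (LinearMap.ker_eq_bot.2 hinj)
  set l' : B →L[ℝ] A := LinearMap.toContinuousLinearMap l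
  have h1 : l'.comp (D x) = 1 := by
    ext a
    exact congrArg (fun T : A →ₗ[ℝ] A => T a) hl
  have h2 : ∀ᶠ y in 𝓝 x, ContDiffAt ℝ ∞ (fun y => l'.comp (D y)) y := by
    filter_upwards [hD] with y hy using contDiffAt_const.clm_comp hy
  refine ⟨fun y => (Ring.inverse (l'.comp (D y))).comp l', ?_⟩
  filter_upwards [eventually_contDiffAt_ringInverse h2 h1] with y hy
  refine ⟨hy.1.clm_comp contDiffAt_const, fun a => ?_⟩
  have := Ring.inverse_mul_cancel _ hy.2
  exact congrArg (fun T : A →L[ℝ] A => T a) this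

/-- A smooth family of linear maps that is surjective at a point has a smooth family of right
inverses nearby. -/
theorem exists_smooth_rightInverse {R : E → B →L[ℝ] A} {x : E}
    (hR : ∀ᶠ y in 𝓝 x, ContDiffAt ℝ ∞ R y) (hsurj : Function.Surjective (R x)) :
    ∃ G : E → A →L[ℝ] B, ∀ᶠ y in 𝓝 x, ContDiffAt ℝ ∞ G y ∧ ∀ a, R y (G y a) = a := by
  obtain ⟨l, hl⟩ := (R x : B →ₗ[ℝ] A).exists_rightInverse_of_surjective
    (LinearMap.range_eq_top.2 hsurj)
  set l' : A →L[ℝ] B := LinearMap.toContinuousLinearMap l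
  have h1 : (R x).comp l' = 1 := by
    ext a
    exact congrArg (fun T : A →ₗ[ℝ] A => T a) hl
  have h2 : ∀ᶠ y in 𝓝 x, ContDiffAt ℝ ∞ (fun y => (R y).comp l') y := by
    filter_upwards [hR] with y hy using hy.clm_comp contDiffAt_const
  refine ⟨fun y => l'.comp (Ring.inverse ((R y).comp l')), ?_⟩
  filter_upwards [eventually_contDiffAt_ringInverse h2 h1] with y hy
  refine ⟨contDiffAt_const.clm_comp hy.1, fun a => ?_⟩
  have := Ring.mul_inverse_cancel _ hy.2
  exact congrArg (fun T : A →L[ℝ] A => T a) this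

/-- The inverse function theorem, with a local right inverse that is smooth near the image point
(and not merely at it). -/
theorem exists_smooth_local_rightInverse {f : A → B} {a : A}
    (hf : ∀ᶠ x in 𝓝 a, ContDiffAt ℝ ∞ f x) (hbij : Function.Bijective (fderiv ℝ f a)) :
    ∃ g : B → A, g (f a) = a ∧ ∀ᶠ y in 𝓝 (f a), ContDiffAt ℝ ∞ g y ∧ f (g y) = y := by
  have : CompleteSpace A := FiniteDimensional.complete ℝ A
  let e : A ≃L[ℝ] B :=
    (LinearEquiv.ofBijective (fderiv ℝ f a : A →ₗ[ℝ] B) hbij).toContinuousLinearEquiv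
  have he : (e : A →L[ℝ] B) = fderiv ℝ f a := by ext; rfl
  have hfa := hf.self_of_nhds
  have hfd : HasFDerivAt f (e : A →L[ℝ] B) a := by
    rw [he]; exact (hfa.differentiableAt (by simp)).hasFDerivAt
  let Φ := hfa.toOpenPartialHomeomorph f hfd (by simp)
  have hsrc : a ∈ Φ.source := hfa.mem_toOpenPartialHomeomorph_source hfd (by simp)
  have htgt : f a ∈ Φ.target := Φ.map_source hsrc
  have hinv : Φ.symm (f a) = a := Φ.left_inv hsrc
  have hdinv : ∀ᶠ x in 𝓝 a, fderiv ℝ f x ∈ range ((↑) : (A ≃L[ℝ] B) → A →L[ℝ] B) := by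
    have hc : ContinuousAt (fderiv ℝ f) a := (hfa.fderiv_right (m := ∞) (by simp)).continuousAt
    exact hc.eventually (by rw [← he]; exact ContinuousLinearEquiv.nhds e)
  have hcont : Tendsto Φ.symm (𝓝 (f a)) (𝓝 a) := by
    have := Φ.continuousAt_symm htgt
    rw [ContinuousAt, hinv] at this
    exact this
  refine ⟨Φ.symm, hinv, ?_⟩
  filter_upwards [Φ.open_target.mem_nhds htgt, hcont.eventually hf, hcont.eventually hdinv]
    with y hy h1 ⟨e', h2⟩
  refine ⟨Φ.contDiffAt_symm (f₀' := e') hy ?_ h1, Φ.right_inv hy⟩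
  rw [h2]
  exact (h1.differentiableAt (by simp)).hasFDerivAt

end RealAnalysis

/-! ### Tangent spaces of level sets -/

section Tangent

variable {F : Type*} [NormedAddCommGroup F] [NormedSpace ℝ F]

theorem mem_tangent_of_curve {S : Set F} {x v : F} {γ : ℝ → F} (h1 : ContDiffAt ℝ ∞ γ 0)
    (h2 : γ 0 = x) (h3 : HasDerivAt γ v 0) (h4 : ∀ᶠ t in 𝓝 (0 : ℝ), γ t ∈ S) :
    v ∈ tangent S x :=
  Submodule.subset_span ⟨γ, h1, h2, h3, h4⟩

/-- The differential of a smooth map with values in `V` takes values in the tangent spaces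
of `V`. -/
theorem fderiv_mem_tangent {L : Type*} [NormedAddCommGroup L] [NormedSpace ℝ L] {V : Set F}
    {ψ : L → F} {s : L} (h : ContDiffAt ℝ ∞ ψ s) (hV : ∀ᶠ s' in 𝓝 s, ψ s' ∈ V) (u : L) :
    fderiv ℝ ψ s u ∈ tangent V (ψ s) := by
  have hline : HasDerivAt (fun t : ℝ => s + t • u) u 0 := by
    simpa using ((hasDerivAt_id (0 : ℝ)).smul_const u).const_add s
  have h0 : s + (0 : ℝ) • u = s := by simp
  refine mem_tangent_of_curve (γ := fun t : ℝ => ψ (s + t • u)) ?_ (by simp) ?_ ?_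
  · refine ContDiffAt.comp (g := ψ) (0 : ℝ) (by rw [h0]; exact h) ?_
    exact contDiffAt_const.add (contDiffAt_id.smul contDiffAt_const)
  · have hd : HasFDerivAt ψ (fderiv ℝ ψ s) (s + (0 : ℝ) • u) := by
      rw [h0]; exact (h.differentiableAt (by simp)).hasFDerivAt
    exact hd.comp_hasDerivAt 0 hline
  · have ht : Tendsto (fun t : ℝ => s + t • u) (𝓝 0) (𝓝 s) := by
      have := hline.continuousAt.tendsto
      rwa [h0] at this
    exact ht.eventually hV

variable {A : Type*} [NormedAddCommGroup A] [NormedSpace ℝ A]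

/-- Tangent vectors of a level set are killed by the differential of a defining map. -/
theorem fderiv_eq_zero_of_mem_tangent {S U : Set F} {r : F → A} {y v : F} (hU : U ∈ 𝓝 y)
    (hr : DifferentiableAt ℝ r y) (h : ∀ z ∈ U, z ∈ S → r z = 0) (hv : v ∈ tangent S y) :
    fderiv ℝ r y v = 0 := by
  suffices tangent S y ≤ LinearMap.ker (fderiv ℝ r y : F →ₗ[ℝ] A) from this hv
  refine Submodule.span_le.2 ?_
  rintro v ⟨γ, -, h0, hd, hS⟩
  have h1 : HasDerivAt (fun t => r (γ t)) (fderiv ℝ r y v) 0 := by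
    refine HasFDerivAt.comp_hasDerivAt (l := r) 0 ?_ hd
    rw [h0]; exact hr.hasFDerivAt
  have h2 : (fun t => r (γ t)) =ᶠ[𝓝 0] fun _ => (0 : A) := by
    have : Tendsto γ (𝓝 0) (𝓝 y) := h0 ▸ hd.continuousAt.tendsto
    filter_upwards [hS, this.eventually hU] with t ht1 ht2 using h _ ht2 ht1
  exact h1.unique ((hasDerivAt_const (0 : ℝ) (0 : A)).congr_of_eventuallyEq h2)

/-- Every vector killed by the surjective differential of a defining map is the velocity of a
smooth curve in the level set. -/
theorem exists_curve_of_fderiv_eq_zero [FiniteDimensional ℝ A] [FiniteDimensional ℝ F]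
    {S U : Set F} {r : F → A} {y v : F}
    (hU : IsOpen U) (hy : y ∈ U) (hr : ContDiffOn ℝ ∞ r U) (h : ∀ z ∈ U, z ∈ S ↔ r z = 0)
    (hyS : y ∈ S) (hs : Function.Surjective (fderiv ℝ r y)) (hv : fderiv ℝ r y v = 0) :
    ∃ γ : ℝ → F, ContDiffAt ℝ ∞ γ 0 ∧ γ 0 = y ∧ HasDerivAt γ v 0 ∧
      ∀ᶠ t in 𝓝 (0 : ℝ), γ t ∈ S := by
  obtain ⟨G, hG⟩ := (fderiv ℝ r y : F →ₗ[ℝ] A).exists_rightInverse_of_surjective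
    (LinearMap.range_eq_top.2 hs)
  have hG' : ∀ a, fderiv ℝ r y (G a) = a := fun a =>
    congrArg (fun T : A →ₗ[ℝ] A => T a) hG
  let G' : A →L[ℝ] F := LinearMap.toContinuousLinearMap G
  -- `f` has derivative `1` at `y` and straightens `r`: `r'(y) ∘ f = r`.
  let f : F → F := fun z => z + G' (r z - fderiv ℝ r y z)
  have hrz : ∀ z ∈ U, ContDiffAt ℝ ∞ r z := fun z hz => hr.contDiffAt (hU.mem_nhds hz)
  have hf : ∀ᶠ z in 𝓝 y, ContDiffAt ℝ ∞ f z := by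
    filter_upwards [hU.mem_nhds hy] with z hz
    exact contDiffAt_id.add (G'.contDiff.contDiffAt.comp z
      ((hrz z hz).sub (fderiv ℝ r y).contDiff.contDiffAt))
  have hfd : HasFDerivAt f (ContinuousLinearMap.id ℝ F) y := by
    have h1 := ((hrz y hy).differentiableAt (by simp)).hasFDerivAt
    have h2 := (hasFDerivAt_id y).add (G'.hasFDerivAt.comp y (h1.sub (fderiv ℝ r y).hasFDerivAt))
    refine h2.congr_fderiv ?_
    simp
  obtain ⟨g, hg0, hg⟩ := exists_smooth_local_rightInverse hf
    (by rw [hfd.fderiv]; exact Function.bijective_id)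
  have hfy : f y = y + G' (-fderiv ℝ r y y) := by
    simp [f, (h y hy).1 hyS]
  have hline : HasDerivAt (fun t : ℝ => f y + t • v) v 0 := by
    simpa using ((hasDerivAt_id (0 : ℝ)).smul_const v).const_add (f y)
  have h0 : f y + (0 : ℝ) • v = f y := by simp
  have hlim : Tendsto (fun t : ℝ => f y + t • v) (𝓝 0) (𝓝 (f y)) := by
    have := hline.continuousAt.tendsto
    rwa [h0] at this
  have hgy := hg.self_of_nhds
  have hγ : ContDiffAt ℝ ∞ (fun t : ℝ => g (f y + t • v)) 0 := by
    refine ContDiffAt.comp (g := g) (0 : ℝ) (by rw [h0]; exact hgy.1) ?_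
    exact contDiffAt_const.add (contDiffAt_id.smul contDiffAt_const)
  have hgd : HasFDerivAt g (fderiv ℝ g (f y)) (f y) :=
    (hgy.1.differentiableAt (by simp)).hasFDerivAt
  have hgid : fderiv ℝ g (f y) = ContinuousLinearMap.id ℝ F := by
    have h1 : HasFDerivAt (fun z => f (g z))
        ((ContinuousLinearMap.id ℝ F).comp (fderiv ℝ g (f y))) (f y) :=
      HasFDerivAt.comp (g := f) (f y) (by rw [hg0]; exact hfd) hgd
    have h2 : (fun z => f (g z)) =ᶠ[𝓝 (f y)] id := by
      filter_upwards [hg] with z hz using hz.2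
    have := h1.unique ((hasFDerivAt_id _).congr_of_eventuallyEq h2)
    simpa using this
  refine ⟨fun t => g (f y + t • v), hγ, by simp [hg0], ?_, ?_⟩
  · have := HasFDerivAt.comp_hasDerivAt (l := g) (l' := fderiv ℝ g (f y)) (0 : ℝ)
      (by rw [h0]; exact hgd) hline
    rwa [hgid] at this
  · have hgU : ∀ᶠ z in 𝓝 (f y), g z ∈ U :=
      hgy.1.continuousAt.eventually (by rw [hg0]; exact hU.mem_nhds hy)
    filter_upwards [hlim.eventually hg, hlim.eventually hgU] with t ht htU
    refine (h _ htU).2 ?_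
    have h3 : fderiv ℝ r y (f (g (f y + t • v))) = r (g (f y + t • v)) := by
      simp [f, G', hG']
    rw [← h3, ht.2, hfy]
    simp [G', hG', hv]

end Tangent

/-! ### The characteristic bundle -/

section Characteristic

variable {E : Type*} [NormedAddCommGroup E] [NormedSpace ℂ E]
  {A : Type*} [NormedAddCommGroup A] [NormedSpace ℝ A]

variable (E) in
/-- Multiplication by `i` as a real linear map. -/
def mulI : E →L[ℝ] E := (Complex.I • ContinuousLinearMap.id ℂ E).restrictScalars ℝ

@[simp]
theorem mulI_apply (v : E) : mulI E v = Complex.I • v := rfl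

theorem I_smul_I_smul (v : E) : Complex.I • Complex.I • v = -v := by
  rw [← mul_smul, Complex.I_mul_I, neg_one_smul]

/-- For a defining map `r` with values in `A` and `l ∈ A*`, the covector `d^c (l ∘ r)` at `y`,
as a linear function of `l`. For `A = ℝ^k` it sends `(λ_j)` to `∑ λ_j d^c ρ_j(y)`. -/
def dcMap (r : E → A) (y : E) : (A →L[ℝ] ℝ) →L[ℝ] (E →L[ℝ] ℝ) :=
  -(ContinuousLinearMap.compL ℝ E A ℝ).flip ((fderiv ℝ r y).comp (mulI E))

theorem dcMap_apply (r : E → A) (y : E) (l : A →L[ℝ] ℝ) (v : E) :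
    dcMap r y l v = -l (fderiv ℝ r y (Complex.I • v)) := rfl

theorem dcMap_apply_I (r : E → A) (y : E) (l : A →L[ℝ] ℝ) (v : E) :
    dcMap r y l (Complex.I • v) = l (fderiv ℝ r y v) := by
  simp [dcMap_apply, I_smul_I_smul]

theorem ContDiffAt.dcMap {r : E → A} {y : E} (hr : ContDiffAt ℝ ∞ r y) :
    ContDiffAt ℝ ∞ (dcMap r) y := by
  refine ContDiffAt.neg ?_
  have hL : ContDiff ℝ ∞ (fun B : E →L[ℝ] A => (ContinuousLinearMap.compL ℝ E A ℝ).flip B) :=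
    ContinuousLinearMap.contDiff (E := E →L[ℝ] A) (F := (A →L[ℝ] ℝ) →L[ℝ] (E →L[ℝ] ℝ)) _
  refine hL.contDiffAt.comp y ?_
  exact (hr.fderiv_right (m := ∞) (by simp)).clm_comp contDiffAt_const

theorem fderiv_dcMap_apply_I {r : E → A} {y : E} (hr : ContDiffAt ℝ ∞ r y) (v w : E)
    (l : A →L[ℝ] ℝ) :
    fderiv ℝ (dcMap r) y v l (Complex.I • w) = l (fderiv ℝ (fderiv ℝ r) y v w) := by
  have h1 : DifferentiableAt ℝ (dcMap r) y := (ContDiffAt.dcMap hr).differentiableAt (by simp)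
  have h2 : DifferentiableAt ℝ (fderiv ℝ r) y :=
    (hr.fderiv_right (m := ∞) (by simp)).differentiableAt (by simp)
  have e1 : HasFDerivAt (fun z => dcMap r z l (Complex.I • w)) _ y :=
    (h1.hasFDerivAt.clm_apply (hasFDerivAt_const l y)).clm_apply
      (hasFDerivAt_const (Complex.I • w) y)
  have e2 : HasFDerivAt (fun z => l (fderiv ℝ r z w)) _ y :=
    l.hasFDerivAt.comp y (h2.hasFDerivAt.clm_apply (hasFDerivAt_const w y))
  simp only [dcMap_apply_I] at e1
  simpa using congrArg (fun T : E →L[ℝ] ℝ => T v) (e1.unique e2)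

/-- `r` is a smooth defining map of `S` on the open set `U`, submersive at all points of `U`,
and at `x` it satisfies the condition `∂ρ₁ ∧ ⋯ ∧ ∂ρ_k ≠ 0` of a generic `CR` submanifold. In terms
of the differential `r'(x) : E → A` this says that `l ∘ r'(x)` and `m ∘ r'(x) ∘ i`, `l, m ∈ A*`,
are linearly independent. -/
structure IsGenericDefining (S U : Set E) (r : E → A) (x : E) : Prop where
  isOpen : IsOpen U
  mem : x ∈ U
  mem_set : x ∈ S
  smooth : ContDiffOn ℝ ∞ r U
  mem_iff : ∀ y ∈ U, y ∈ S ↔ r y = 0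
  surjective : ∀ y ∈ U, Function.Surjective (fderiv ℝ r y)
  generic : ∀ l m : A →L[ℝ] ℝ,
    (∀ v, l (fderiv ℝ r x v) + m (fderiv ℝ r x (Complex.I • v)) = 0) → l = 0 ∧ m = 0

namespace IsGenericDefining

variable {S U : Set E} {r : E → A} {x : E} (h : IsGenericDefining S U r x)
include h

theorem contDiffAt {y : E} (hy : y ∈ U) : ContDiffAt ℝ ∞ r y :=
  h.smooth.contDiffAt (h.isOpen.mem_nhds hy)

theorem dcMap_injective {y : E} (hy : y ∈ U) : Function.Injective (dcMap r y) := by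
  refine (injective_iff_map_eq_zero _).2 fun l hl => ?_
  ext a
  obtain ⟨v, rfl⟩ := h.surjective y hy a
  rw [← dcMap_apply_I, hl]
  simp

variable [FiniteDimensional ℝ A] [FiniteDimensional ℝ E]

omit [FiniteDimensional ℝ A] [FiniteDimensional ℝ E] in
theorem fderiv_eq_zero {y v : E} (hy : y ∈ U) (hv : v ∈ tangent S y) : fderiv ℝ r y v = 0 :=
  fderiv_eq_zero_of_mem_tangent (h.isOpen.mem_nhds hy)
    ((h.contDiffAt hy).differentiableAt (by simp)) (fun z hz => (h.mem_iff z hz).1) hv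

theorem mem_tangent_iff {y v : E} (hy : y ∈ U) (hyS : y ∈ S) :
    v ∈ tangent S y ↔ fderiv ℝ r y v = 0 := by
  refine ⟨h.fderiv_eq_zero hy, fun hv => ?_⟩
  exact Submodule.subset_span (exists_curve_of_fderiv_eq_zero h.isOpen hy h.smooth h.mem_iff hyS
    (h.surjective y hy) hv)

omit [FiniteDimensional ℝ A] [FiniteDimensional ℝ E] in
theorem dcMap_mem_charBundle {y : E} (hy : y ∈ U) (hyS : y ∈ S) (l : A →L[ℝ] ℝ) :
    (y, dcMap r y l) ∈ charBundle S :=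
  ⟨hyS, fun v hv => by
    show dcMap r y l (Complex.I • v) = 0
    rw [dcMap_apply_I, h.fderiv_eq_zero hy hv, map_zero]⟩

theorem exists_dcMap_of_mem_charBundle {y : E} {ξ : E →L[ℝ] ℝ} (hy : y ∈ U)
    (hξ : (y, ξ) ∈ charBundle S) : ∃ l, ξ = dcMap r y l := by
  obtain ⟨G, hG⟩ := (fderiv ℝ r y : E →ₗ[ℝ] A).exists_rightInverse_of_surjective
    (LinearMap.range_eq_top.2 (h.surjective y hy))
  have hG' : ∀ a, fderiv ℝ r y (G a) = a := fun a =>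
    congrArg (fun T : A →ₗ[ℝ] A => T a) hG
  let G' : A →L[ℝ] E := LinearMap.toContinuousLinearMap G
  refine ⟨(ξ.comp (mulI E)).comp G', ?_⟩
  have key : ∀ v, ξ (Complex.I • G' (fderiv ℝ r y v)) = ξ (Complex.I • v) := by
    intro v
    have h1 : v - G' (fderiv ℝ r y v) ∈ tangent S y := by
      rw [h.mem_tangent_iff hy hξ.1, map_sub, sub_eq_zero]
      exact (hG' _).symm
    have h2 : ξ (Complex.I • (v - G' (fderiv ℝ r y v))) = 0 := hξ.2 _ h1
    rw [smul_sub, map_sub, sub_eq_zero] at h2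
    exact h2.symm
  ext v
  rw [dcMap_apply]
  simp only [ContinuousLinearMap.comp_apply, mulI_apply]
  rw [key, I_smul_I_smul, map_neg, neg_neg]

/-- Tangent vectors of the characteristic bundle, obtained by differentiating
`ξ = ∑ λ_j d^c ρ_j`. -/
theorem exists_of_mem_tangent_charBundle {y : E} {l : A →L[ℝ] ℝ} {X : E × (E →L[ℝ] ℝ)}
    (hy : y ∈ U) (hX : X ∈ tangent (charBundle S) (y, dcMap r y l)) :
    X.1 ∈ tangent S y ∧ ∃ m, X.2 = fderiv ℝ (dcMap r) y X.1 l + dcMap r y m := by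
  have hD : ∀ᶠ z in 𝓝 y, ContDiffAt ℝ ∞ (dcMap r) z := by
    filter_upwards [h.isOpen.mem_nhds hy] with z hz using ContDiffAt.dcMap (h.contDiffAt hz)
  obtain ⟨c, hc⟩ := exists_smooth_leftInverse hD (h.dcMap_injective hy)
  unfold tangent at hX
  induction hX using Submodule.span_induction with
  | zero => exact ⟨zero_mem _, 0, by simp⟩
  | add X Y _ _ hX hY =>
    obtain ⟨h1, m1, e1⟩ := hX
    obtain ⟨h2, m2, e2⟩ := hY
    refine ⟨add_mem h1 h2, m1 + m2, ?_⟩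
    simp only [Prod.fst_add, Prod.snd_add, map_add, add_apply, e1, e2]
    abel
  | smul a X _ hX =>
    obtain ⟨h1, m1, e1⟩ := hX
    refine ⟨Submodule.smul_mem _ _ h1, a • m1, ?_⟩
    simp only [Prod.smul_fst, Prod.smul_snd, map_smul, smul_apply, e1, smul_add]
  | mem X hX =>
    obtain ⟨γ, hγ, h0, hd, hS⟩ := hX
    have hd1 : HasDerivAt (fun t => (γ t).1) X.1 0 := 
      (ContinuousLinearMap.fst ℝ E (E →L[ℝ] ℝ)).hasFDerivAt.comp_hasDerivAt 0 hd
    have hd2 : HasDerivAt (fun t => (γ t).2) X.2 0 := 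
      (ContinuousLinearMap.snd ℝ E (E →L[ℝ] ℝ)).hasFDerivAt.comp_hasDerivAt 0 hd
    have h01 : (γ 0).1 = y := by rw [h0]
    have h02 : (γ 0).2 = dcMap r y l := by rw [h0]
    refine ⟨mem_tangent_of_curve hγ.fst h01 hd1 (hS.mono fun t ht => ht.1), ?_⟩
    have hlim : Tendsto (fun t => (γ t).1) (𝓝 0) (𝓝 y) := h01 ▸ hd1.continuousAt.tendsto
    have hcy := hc.self_of_nhds
    have hcd : HasDerivAt (fun t => c (γ t).1) (fderiv ℝ c y X.1) 0 :=
      HasFDerivAt.comp_hasDerivAt (l := c) 0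
        (by rw [h01]; exact (hcy.1.differentiableAt (by simp)).hasFDerivAt) hd1
    have hDd : HasDerivAt (fun t => dcMap r (γ t).1) (fderiv ℝ (dcMap r) y X.1) 0 :=
      HasFDerivAt.comp_hasDerivAt (l := dcMap r) 0
        (by rw [h01]; exact (hD.self_of_nhds.differentiableAt (by simp)).hasFDerivAt) hd1
    have e1 := hDd.clm_apply (hcd.clm_apply hd2)
    have e2 : (fun t => dcMap r (γ t).1 (c (γ t).1 (γ t).2)) =ᶠ[𝓝 0] fun t => (γ t).2 := by
      filter_upwards [hS, hlim.eventually hc, hlim.eventually (h.isOpen.mem_nhds hy)]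
        with t ht1 ht2 ht3
      obtain ⟨l', hl'⟩ := h.exists_dcMap_of_mem_charBundle ht3 ht1
      rw [hl', ht2.2]
    have e3 := e1.unique (hd2.congr_of_eventuallyEq e2)
    rw [h01, h02, hcy.2] at e3
    exact ⟨_, e3.symm⟩

theorem mem_tangent_charBundle {y : E} {l m : A →L[ℝ] ℝ} {v : E}
    (hy : y ∈ U) (hyS : y ∈ S) (hv : fderiv ℝ r y v = 0) :
    (v, fderiv ℝ (dcMap r) y v l + dcMap r y m) ∈
      tangent (charBundle S) (y, dcMap r y l) := by
  obtain ⟨γ, hγ, h0, hd, hS⟩ := exists_curve_of_fderiv_eq_zero h.isOpen hy h.smooth h.mem_iff hyS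
    (h.surjective y hy) hv
  have hD := ContDiffAt.dcMap (h.contDiffAt hy)
  have hline : HasDerivAt (fun t : ℝ => l + t • m) m 0 := by
    simpa using ((hasDerivAt_id (0 : ℝ)).smul_const m).const_add l
  refine mem_tangent_of_curve (γ := fun t => (γ t, dcMap r (γ t) (l + t • m))) ?_ (by simp [h0])
    ?_ ?_
  · refine hγ.prodMk (ContDiffAt.clm_apply ?_ ?_)
    · exact ContDiffAt.comp (g := dcMap r) (0 : ℝ) (by rw [h0]; exact hD) hγ
    · exact contDiffAt_const.add (contDiffAt_id.smul contDiffAt_const)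
  · have hDd : HasDerivAt (fun t => dcMap r (γ t)) (fderiv ℝ (dcMap r) y v) 0 :=
      HasFDerivAt.comp_hasDerivAt (l := dcMap r) 0
        (by rw [h0]; exact (hD.differentiableAt (by simp)).hasFDerivAt) hd
    have := hd.prodMk (hDd.clm_apply hline)
    simpa [h0] using this
  · have hlim : Tendsto γ (𝓝 0) (𝓝 y) := h0 ▸ hd.continuousAt.tendsto
    filter_upwards [hS, hlim.eventually (h.isOpen.mem_nhds hy)] with t h1 h2
    exact h.dcMap_mem_charBundle h2 h1 _

/-- The characteristic bundle is Lagrangian for the real part of the complex symplectic form of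
`T*E`, because there it is, up to the complex structure, the conormal bundle of `S`. -/
theorem lagrangian {q X Y : E × (E →L[ℝ] ℝ)} (hq : q.1 ∈ U) (hqS : q ∈ charBundle S)
    (hX : X ∈ tangent (charBundle S) q) (hY : Y ∈ tangent (charBundle S) q) :
    X.2 (Complex.I • Y.1) = Y.2 (Complex.I • X.1) := by
  obtain ⟨y, ξ⟩ := q
  change y ∈ U at hq
  obtain ⟨l, rfl⟩ := h.exists_dcMap_of_mem_charBundle hq hqS
  obtain ⟨hX1, m, hX2⟩ := h.exists_of_mem_tangent_charBundle hq hX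
  obtain ⟨hY1, m', hY2⟩ := h.exists_of_mem_tangent_charBundle hq hY
  have hr := h.contDiffAt hq
  have hsymm : IsSymmSndFDerivAt ℝ r y := hr.isSymmSndFDerivAt (by
    simp only [minSmoothness_of_isRCLikeNormedField]
    exact WithTop.coe_le_coe.2 (le_top : (2 : ℕ∞) ≤ ⊤))
  rw [hX2, hY2, add_apply, add_apply, fderiv_dcMap_apply_I hr, fderiv_dcMap_apply_I hr,
    dcMap_apply_I, dcMap_apply_I, h.fderiv_eq_zero hq hX1, h.fderiv_eq_zero hq hY1,
    hsymm X.1 Y.1, map_zero, map_zero]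

end IsGenericDefining

end Characteristic

/-! ### The complex symplectic form -/

section Annihilator

variable {E : Type*} [NormedAddCommGroup E] [NormedSpace ℂ E]

theorem extD_taut (q X Y : E × (E →L[ℝ] ℝ)) : extD taut q X Y = X.2 Y.1 - Y.2 X.1 := by
  let T : (E × (E →L[ℝ] ℝ)) →L[ℝ] ((E × (E →L[ℝ] ℝ)) →L[ℝ] ℝ) :=
    ((ContinuousLinearMap.compL ℝ (E × (E →L[ℝ] ℝ)) E ℝ).flip
      (ContinuousLinearMap.fst ℝ E (E →L[ℝ] ℝ))).comp (ContinuousLinearMap.snd ℝ E (E →L[ℝ] ℝ))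
  have hT : (taut : E × (E →L[ℝ] ℝ) → _) = T := rfl
  have hd : fderiv ℝ (taut : E × (E →L[ℝ] ℝ) → _) q = T := by
    rw [hT]
    exact ContinuousLinearMap.fderiv (E := E × (E →L[ℝ] ℝ)) (F := (E × (E →L[ℝ] ℝ)) →L[ℝ] ℝ) T
  rw [extD, hd]
  rfl

/-- The vectors of `T*E` annihilated by the tangent space of the characteristic bundle at `q` with
respect to both the real and the imaginary part of the complex symplectic form of `T*E`. -/
def charAnn (S : Set E) (q : E × (E →L[ℝ] ℝ)) : Submodule ℝ (E × (E →L[ℝ] ℝ)) where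
  carrier := {X | ∀ Y ∈ tangent (charBundle S) q,
    X.2 Y.1 = Y.2 X.1 ∧ X.2 (Complex.I • Y.1) = Y.2 (Complex.I • X.1)}
  zero_mem' := fun Y _ => by simp
  add_mem' := by
    intro X X' hX hX' Y hY
    simp [hX Y hY, hX' Y hY]
  smul_mem' := by
    intro c X hX Y hY
    have : Complex.I • c • X.1 = c • Complex.I • X.1 := smul_comm _ _ _
    simp [hX Y hY, this]

/-- The complex structure of `T*E`, when a real covector is identified with the `(1,0)`-form whose
imaginary part it is. -/
def cotJ (X : E × (E →L[ℝ] ℝ)) : E × (E →L[ℝ] ℝ) := (Complex.I • X.1, X.2.comp (mulI E))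

theorem cotJ_mem_charAnn {S : Set E} {q X : E × (E →L[ℝ] ℝ)} (hX : X ∈ charAnn S q) :
    cotJ X ∈ charAnn S q := by
  intro Y hY
  refine ⟨(hX Y hY).2, ?_⟩
  simp only [cotJ, ContinuousLinearMap.comp_apply, mulI_apply, I_smul_I_smul, map_neg, (hX Y hY).1]

end Annihilator

/-! ### The kernel of the Levi form -/

section Levi

variable {E : Type*} [NormedAddCommGroup E] [NormedSpace ℂ E]

theorem smul_eq_re_add_im (c : ℂ) (v : E) : c • v = c.re • v + c.im • (Complex.I • v) := by
  conv_lhs => rw [← Complex.re_add_im c]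
  rw [add_smul, mul_smul, Complex.coe_smul, Complex.coe_smul]

theorem extD_antisymm {F : Type*} [NormedAddCommGroup F] [NormedSpace ℝ F] (α : F → F →L[ℝ] ℝ)
    (x u w : F) : extD α x u w = -extD α x w u := by
  simp [extD]

theorem extD_add_right {F : Type*} [NormedAddCommGroup F] [NormedSpace ℝ F] (α : F → F →L[ℝ] ℝ)
    (x u v w : F) : extD α x u (v + w) = extD α x u v + extD α x u w := by
  rw [extD_antisymm, extD_add_left, extD_antisymm α x v, extD_antisymm α x w]
  ring

theorem extD_smul_right {F : Type*} [NormedAddCommGroup F] [NormedSpace ℝ F] (α : F → F →L[ℝ] ℝ)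
    (x : F) (c : ℝ) (u w : F) : extD α x u (c • w) = c * extD α x u w := by
  rw [extD_antisymm, extD_smul_left, extD_antisymm α x w]
  ring

/-- The Levi form is complex linear in its second argument. -/
theorem leviForm_smul_right (σ : E → E →L[ℝ] ℝ) (x : E) (c : ℂ) (v w : E) :
    leviForm σ x v (c • w) = c * leviForm σ x v w := by
  have hneg : ∀ u, extD σ x v (-u) = -extD σ x v u := fun u => by
    simpa using extD_smul_right σ x (-1) v u
  unfold leviForm
  rw [smul_comm, smul_eq_re_add_im c (Complex.I • w), smul_eq_re_add_im c w]
  simp only [extD_add_right, extD_smul_right, I_smul_I_smul, hneg]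
  conv_rhs => rw [← Complex.re_add_im c]
  push_cast
  linear_combination (-c.im * extD σ x v w : ℂ) * Complex.I_sq

/-- The graph of the differential of a section of the characteristic bundle is tangent to it. -/
theorem section_mem_tangent {S : Set E} {x w : E} {ξ : E →L[ℝ] ℝ} {σ : E → E →L[ℝ] ℝ}
    (hσ : IsCharSection S x ξ σ) (hw : w ∈ tangent S x) :
    (w, fderiv ℝ σ x w) ∈ tangent (charBundle S) (x, ξ) := by
  suffices tangent S x ≤ (tangent (charBundle S) (x, ξ)).comap
      ((ContinuousLinearMap.id ℝ E).prod (fderiv ℝ σ x) : E →ₗ[ℝ] E × (E →L[ℝ] ℝ)) from this hw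
  refine Submodule.span_le.2 ?_
  rintro w ⟨γ, hγ, h0, hd, hS⟩
  refine mem_tangent_of_curve (γ := fun t => (γ t, σ (γ t))) ?_ (by simp [h0, hσ.2.1]) ?_ ?_
  · exact hγ.prodMk (ContDiffAt.comp (g := σ) (0 : ℝ) (by rw [h0]; exact hσ.1) hγ)
  · refine hd.prodMk (HasFDerivAt.comp_hasDerivAt (l := σ) 0 ?_ hd)
    rw [h0]; exact (hσ.1.differentiableAt (by simp)).hasFDerivAt
  · have hlim : Tendsto γ (𝓝 0) (𝓝 x) := h0 ▸ hd.continuousAt.tendsto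
    filter_upwards [hS, hlim.eventually hσ.2.2] with t h1 h2 using h2 h1

theorem vertical_mem_tangent {S : Set E} {x : E} {ξ η : E →L[ℝ] ℝ}
    (hξ : (x, ξ) ∈ charBundle S) (hη : (x, η) ∈ charBundle S) :
    ((0 : E), η) ∈ tangent (charBundle S) (x, ξ) := by
  have hline : HasDerivAt (fun t : ℝ => ξ + t • η) η 0 := by
    simpa using ((hasDerivAt_id (0 : ℝ)).smul_const η).const_add ξ
  refine mem_tangent_of_curve (γ := fun t : ℝ => (x, ξ + t • η)) ?_ (by simp)
    ((hasDerivAt_const _ _).prodMk hline) (Eventually.of_forall fun t => ⟨hξ.1, fun v hv => ?_⟩)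
  · exact contDiffAt_const.prodMk
      (contDiffAt_const.add (contDiffAt_id.smul contDiffAt_const))
  · have h1 : ξ (Complex.I • v) = 0 := hξ.2 v hv
    have h2 : η (Complex.I • v) = 0 := hη.2 v hv
    simp [h1, h2]

namespace IsGenericDefining

variable {A : Type*} [NormedAddCommGroup A] [NormedSpace ℝ A] [FiniteDimensional ℝ A]
  [FiniteDimensional ℝ E] {S U : Set E} {r : E → A} {x : E} (h : IsGenericDefining S U r x)
include h

theorem charH_le_charAnn {q : E × (E →L[ℝ] ℝ)} (hq : q.1 ∈ U) (hqS : q ∈ charBundle S) :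
    charH S q ≤ charAnn S q := by
  intro X hX Y hY
  refine ⟨?_, h.lagrangian hq hqS hX.1.1 hY⟩
  have := hX.2 Y hY
  rw [extD_taut] at this
  linarith

/-- The symmetry `dσ(iv, w) = -dσ(v, iw)` behind the Hermitian symmetry of the Levi form. -/
theorem extD_section_I_left {ξ : E →L[ℝ] ℝ} {σ : E → E →L[ℝ] ℝ} (hσ : IsCharSection S x ξ σ)
    {v w : E} (hv : v ∈ holTangent S x) (hw : w ∈ holTangent S x) :
    extD σ x (Complex.I • v) w = -extD σ x v (Complex.I • w) := by
  have hξ : (x, ξ) ∈ charBundle S := hσ.2.1 ▸ hσ.2.2.self_of_nhds h.mem_set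
  have h1 := h.lagrangian h.mem hξ (section_mem_tangent hσ hv.1) (section_mem_tangent hσ hw.1)
  have h2 := h.lagrangian h.mem hξ (section_mem_tangent hσ hv.2) (section_mem_tangent hσ hw.2)
  simp only [I_smul_I_smul, map_neg, neg_inj] at h1 h2
  rw [extD, extD, h1, h2]
  ring

/-- The kernel of the Levi form, as a complex subspace of the holomorphic tangent space. -/
def leviKer {ξ : E →L[ℝ] ℝ} {σ : E → E →L[ℝ] ℝ} (hσ : IsCharSection S x ξ σ) :
    Submodule ℂ E where
  carrier := {v | v ∈ holTangent S x ∧ ∀ w ∈ holTangent S x, extD σ x v w = 0}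
  zero_mem' := ⟨zero_mem _, fun w _ => by simp [extD]⟩
  add_mem' := by
    rintro a b ⟨h1, h2⟩ ⟨h3, h4⟩
    exact ⟨add_mem h1 h3, fun w hw => by rw [extD_add_left, h2 w hw, h4 w hw, add_zero]⟩
  smul_mem' := by
    rintro c v ⟨h1, h2⟩
    refine ⟨Submodule.smul_mem _ _ h1, fun w hw => ?_⟩
    rw [smul_eq_re_add_im c v, extD_add_left, extD_smul_left, extD_smul_left, h2 w hw,
      h.extD_section_I_left hσ h1 hw, h2 _ ((holTangent S x).smul_mem Complex.I hw)]
    ring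

variable {ξ : E →L[ℝ] ℝ} {σ : E → E →L[ℝ] ℝ} (hσ : IsCharSection S x ξ σ)

omit [FiniteDimensional ℝ A] [FiniteDimensional ℝ E] in
include hσ in
theorem section_mem_charBundle : (x, ξ) ∈ charBundle S :=
  hσ.2.1 ▸ hσ.2.2.self_of_nhds h.mem_set

theorem fst_mem_leviKer_of_mem_charAnn {X : E × (E →L[ℝ] ℝ)} (hX : X ∈ charAnn S (x, ξ)) :
    X.1 ∈ h.leviKer hσ := by
  have hξ := h.section_mem_charBundle hσ
  -- Pairing with vertical vectors shows that `X.1` and `i X.1` are tangent to `S`.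
  have hvert : ∀ l : A →L[ℝ] ℝ, l (fderiv ℝ r x X.1) = 0 ∧
      l (fderiv ℝ r x (Complex.I • X.1)) = 0 := by
    intro l
    have := hX _ (vertical_mem_tangent hξ (h.dcMap_mem_charBundle h.mem h.mem_set l))
    simp only [smul_zero, map_zero, dcMap_apply_I] at this
    refine ⟨this.2.symm, ?_⟩
    have h2 := this.1.symm
    rwa [dcMap_apply, neg_eq_zero] at h2
  have hzero : ∀ a : A, (∀ l : A →L[ℝ] ℝ, l a = 0) → a = 0 := fun a ha => by
    by_contra hne
    obtain ⟨l, hl⟩ := SeparatingDual.exists_ne_zero (R := ℝ) hne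
    exact hl (ha l)
  have hhol : X.1 ∈ holTangent S x :=
    ⟨(h.mem_tangent_iff h.mem h.mem_set).2 (hzero _ fun l => (hvert l).1),
      (h.mem_tangent_iff h.mem h.mem_set).2 (hzero _ fun l => (hvert l).2)⟩
  refine ⟨hhol, fun w hw => ?_⟩
  have h1 := (hX _ (section_mem_tangent hσ hw.1)).1
  have h2 := (hX _ (section_mem_tangent hσ hw.2)).2
  have h3 := h.lagrangian h.mem hξ (section_mem_tangent hσ hhol.1) (section_mem_tangent hσ hw.2)
  simp only [I_smul_I_smul, map_neg] at h1 h2 h3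
  rw [extD]
  linarith

include h hσ in
theorem eq_zero_of_mem_charAnn {X : E × (E →L[ℝ] ℝ)} (hX : X ∈ charAnn S (x, ξ))
    (hX1 : X.1 = 0) : X = 0 := by
  obtain ⟨v, η⟩ := X
  change v = 0 at hX1
  subst hX1
  -- `η` and `η ∘ i` vanish on `T_x S`, and `T_x S + i T_x S = E`.
  have hker : ∀ w, fderiv ℝ r x w = 0 → η w = 0 ∧ η (Complex.I • w) = 0 := by
    intro w hw
    have := hX _ (section_mem_tangent hσ ((h.mem_tangent_iff h.mem h.mem_set).2 hw))
    simpa using this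
  obtain ⟨G, hG⟩ := (fderiv ℝ r x : E →ₗ[ℝ] A).exists_rightInverse_of_surjective
    (LinearMap.range_eq_top.2 (h.surjective x h.mem))
  have hG' : ∀ a, fderiv ℝ r x (G a) = a := fun a =>
    congrArg (fun T : A →ₗ[ℝ] A => T a) hG
  let G' : A →L[ℝ] E := LinearMap.toContinuousLinearMap G
  have hsub : ∀ w, fderiv ℝ r x (w - G' (fderiv ℝ r x w)) = 0 := by
    intro w
    rw [map_sub, sub_eq_zero]
    exact (hG' _).symm
  have e1 : ∀ w, η w = (η.comp G') (fderiv ℝ r x w) := by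
    intro w
    have := (hker _ (hsub w)).1
    rw [map_sub, sub_eq_zero] at this
    exact this
  have e2 : ∀ w, η (Complex.I • w) = ((η.comp (mulI E)).comp G') (fderiv ℝ r x w) := by
    intro w
    have := (hker _ (hsub w)).2
    rw [smul_sub, map_sub, sub_eq_zero] at this
    exact this
  obtain ⟨h1, -⟩ := h.generic (η.comp G') ((η.comp (mulI E)).comp G') (fun w => by
    rw [← e1, ← e2, I_smul_I_smul, map_neg, add_neg_cancel])
  refine Prod.ext rfl ?_
  ext w
  rw [e1, h1]
  simp

/-- Every vector of the Levi kernel lifts to `H_ξ H⁰S`. The lift is corrected by a vertical vector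
that is obtained from `(T ∩ iT)^⊥ = T^⊥ + (iT)^⊥` for `T = T_x S`. -/
theorem exists_mem_charH_of_mem_leviKer {v : E} (hv : v ∈ h.leviKer hσ) :
    ∃ X ∈ charH S (x, ξ), X.1 = v := by
  have hξ := h.section_mem_charBundle hσ
  obtain ⟨hv1, hv2⟩ := hv
  let T : Submodule ℝ E := tangent S x
  let T' : Submodule ℝ E := T.comap (mulI E : E →ₗ[ℝ] E)
  let f : Module.Dual ℝ E :=
    { toFun := fun w => extD σ x v w
      map_add' := fun a b => extD_add_right σ x v a b
      map_smul' := fun c a => extD_smul_right σ x c v a }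
  have hf : f ∈ (T ⊓ T').dualAnnihilator := by
    rw [Submodule.mem_dualAnnihilator]
    exact fun w hw => hv2 w hw
  rw [Subspace.dualAnnihilator_inf_eq, Submodule.mem_sup] at hf
  obtain ⟨a, ha, b, hb, hab⟩ := hf
  rw [Submodule.mem_dualAnnihilator] at ha hb
  let b' : E →L[ℝ] ℝ := LinearMap.toContinuousLinearMap b
  have hb' : (x, b') ∈ charBundle S := by
    refine ⟨h.mem_set, fun w hw => ?_⟩
    refine hb (Complex.I • w) ?_
    show Complex.I • Complex.I • w ∈ T
    rw [I_smul_I_smul]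
    exact neg_mem hw
  have hX : (v, fderiv ℝ σ x v - b') ∈ tangent (charBundle S) (x, ξ) := by
    have := sub_mem (section_mem_tangent hσ hv1.1) (vertical_mem_tangent hξ hb')
    simpa using this
  have hξH : ∀ w ∈ holTangent S x, ∀ η, (x, η) ∈ charBundle S → η w = 0 := by
    intro w hw η hη
    have : η (Complex.I • Complex.I • w) = 0 := hη.2 _ hw.2
    rwa [I_smul_I_smul, map_neg, neg_eq_zero] at this
  refine ⟨_, ⟨⟨hX, hξH v hv1 ξ hξ⟩, fun Y hY => ?_⟩, rfl⟩
  obtain ⟨l, hl⟩ := h.exists_dcMap_of_mem_charBundle h.mem hξ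
  rw [hl] at hY
  obtain ⟨hY1, m, hY2⟩ := h.exists_of_mem_tangent_charBundle h.mem hY
  have hY' := section_mem_tangent hσ hY1
  rw [hl] at hY'
  obtain ⟨-, m', hY2'⟩ := h.exists_of_mem_tangent_charBundle h.mem hY'
  change fderiv ℝ σ x Y.1 = fderiv ℝ (dcMap r) x Y.1 l + dcMap r x m' at hY2'
  have h1 : Y.2 v = fderiv ℝ σ x Y.1 v := by
    rw [hY2, hY2', add_apply, add_apply,
      hξH v hv1 _ (h.dcMap_mem_charBundle h.mem h.mem_set m),
      hξH v hv1 _ (h.dcMap_mem_charBundle h.mem h.mem_set m')]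
  have h2 : a Y.1 + b' Y.1 = extD σ x v Y.1 := congrArg (fun g : Module.Dual ℝ E => g Y.1) hab
  rw [ha Y.1 hY1, zero_add, extD] at h2
  rw [extD_taut]
  simp only [sub_apply]
  rw [h1, h2]
  ring

theorem finrank_leviKer {n m : ℕ} (b : Module.Basis (Fin n) ℂ (holTangent S x))
    (hm : (Matrix.of fun i j : Fin n => leviForm σ x (b i : E) (b j : E)).rank = m) :
    Module.finrank ℂ (h.leviKer hσ) = n - m := by
  set G : Matrix (Fin n) (Fin n) ℂ := Matrix.of fun i j => leviForm σ x (b i : E) (b j : E)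
  have hle : h.leviKer hσ ≤ holTangent S x := fun v hv => hv.1
  have hadd : ∀ v (s : Finset (Fin n)) (f : Fin n → E), leviForm σ x v (∑ j ∈ s, f j) =
      ∑ j ∈ s, leviForm σ x v (f j) := by
    intro v s f
    let φ : E →+ ℂ := AddMonoidHom.mk' (fun w => leviForm σ x v w) (fun a b => by
      simp only [leviForm, smul_add, extD_add_right]
      push_cast
      ring)
    exact map_sum φ f s
  have hmul : ∀ (c : Fin n → ℂ) (i : Fin n), G.mulVec c i =
      leviForm σ x (b i : E) (b.equivFun.symm c : E) := by
    intro c i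
    rw [Module.Basis.equivFun_symm_apply, Submodule.coe_sum, hadd]
    simp only [Matrix.mulVec, dotProduct, G, Matrix.of_apply]
    refine Finset.sum_congr rfl fun j _ => ?_
    rw [Submodule.coe_smul, leviForm_smul_right, mul_comm]
  have hker : LinearMap.ker G.mulVecLin =
      ((h.leviKer hσ).comap (holTangent S x).subtype).comap
        (b.equivFun.symm : (Fin n → ℂ) →ₗ[ℂ] holTangent S x) := by
    ext c
    set w : holTangent S x := b.equivFun.symm c with hw
    rw [LinearMap.mem_ker, Matrix.mulVecLin_apply]
    constructor
    · intro hc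
      refine ⟨w.2, fun v hv => ?_⟩
      let K : Submodule ℂ (holTangent S x) :=
        { carrier := {v | extD σ x (v : E) w = 0 ∧ extD σ x (v : E) (Complex.I • (w : E)) = 0}
          zero_mem' := by simp [extD]
          add_mem' := by
            rintro p q ⟨h1, h2⟩ ⟨h3, h4⟩
            exact ⟨by rw [Submodule.coe_add, extD_add_left, h1, h3, add_zero],
              by rw [Submodule.coe_add, extD_add_left, h2, h4, add_zero]⟩
          smul_mem' := by
            rintro a p ⟨h1, h2⟩
            have key : ((a • p : holTangent S x) : E) =
                a.re • (p : E) + a.im • (Complex.I • (p : E)) :=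
              smul_eq_re_add_im a (p : E)
            have hIw := (holTangent S x).smul_mem Complex.I w.2
            have hneg : extD σ x (p : E) (-(w : E)) = -extD σ x (p : E) w := by
              simpa using extD_smul_right σ x (-1) (p : E) w
            constructor
            · rw [key, extD_add_left, extD_smul_left, extD_smul_left, h1,
                h.extD_section_I_left hσ p.2 w.2, h2]
              ring
            · rw [key, extD_add_left, extD_smul_left, extD_smul_left, h2,
                h.extD_section_I_left hσ p.2 hIw, I_smul_I_smul, hneg, h1]
              ring }
      have htop : K = ⊤ := by
        rw [← top_le_iff, ← b.span_eq, Submodule.span_le]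
        rintro _ ⟨i, rfl⟩
        have h0 : leviForm σ x (b i : E) (w : E) = 0 := by
          rw [hw, ← hmul, hc]; rfl
        have hre := congrArg Complex.re h0
        have him := congrArg Complex.im h0
        simp [leviForm] at hre him
        exact ⟨him, hre⟩
      have hvK : (⟨v, hv⟩ : holTangent S x) ∈ K := by rw [htop]; trivial
      rw [extD_antisymm, neg_eq_zero]
      exact hvK.1
    · intro hc
      have hc' : (w : E) ∈ h.leviKer hσ := hc
      ext i
      rw [hmul, ← hw]
      have h1 : extD σ x (b i : E) w = 0 := by
        rw [extD_antisymm, hc'.2 _ (b i).2, neg_zero]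
      have h2 : extD σ x (b i : E) (Complex.I • (w : E)) = 0 := by
        rw [extD_antisymm, h.extD_section_I_left hσ w.2 (b i).2,
          hc'.2 _ ((holTangent S x).smul_mem Complex.I (b i).2), neg_zero, neg_zero]
      simp [leviForm, h1, h2]
  have h1 := LinearMap.finrank_range_add_finrank_ker G.mulVecLin
  have h2 : Module.finrank ℂ (LinearMap.range G.mulVecLin) = m := hm
  have h3 : Module.finrank ℂ (LinearMap.ker G.mulVecLin) =
      Module.finrank ℂ (h.leviKer hσ) := by
    rw [hker, LinearEquiv.finrank_eq (Submodule.comapSubtypeEquivOfLe hle).symm]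
    exact LinearEquiv.finrank_eq (LinearEquiv.ofSubmodule' b.equivFun.symm _)
  rw [h2, h3, Module.finrank_fin_fun] at h1
  omega

end IsGenericDefining

end Levi

/-! ### Parametrizations of submanifolds -/

section Parametrization

variable {F : Type*} [NormedAddCommGroup F] [NormedSpace ℝ F] [FiniteDimensional ℝ F]

/-- A submanifold of a vector space is parametrized near each of its points by a smooth immersion
whose differential at the origin is onto the tangent space. -/
theorem IsSubmanifold.exists_param {d : ℕ} {V : Set F} (hV : IsSubmanifold ℝ F d V) {p : F}
    (hp : p ∈ V) : ∃ (L : Submodule ℝ F) (ψ : L → F), ψ 0 = p ∧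
      (∀ᶠ s in 𝓝 (0 : L), ContDiffAt ℝ ∞ ψ s ∧ ψ s ∈ V) ∧
      Function.Injective (fderiv ℝ ψ 0) ∧ ∀ v ∈ tangent V p, ∃ s, fderiv ℝ ψ 0 s = v := by
  obtain ⟨φ, hφ, hps, L, -, hL⟩ := hV p hp
  have h1 : ContDiffOn ℝ ∞ φ φ.source :=
    contMDiffOn_iff_contDiffOn.1 (contMDiffOn_of_mem_maximalAtlas hφ)
  have h2 : ContDiffOn ℝ ∞ φ.symm φ.target :=
    contMDiffOn_iff_contDiffOn.1 (contMDiffOn_symm_of_mem_maximalAtlas hφ)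
  have hpL : φ p ∈ L := (hL p hps).1 hp
  let ψ : L → F := fun s => φ.symm (φ p + s)
  have hψ0 : ψ 0 = p := by simp [ψ, φ.left_inv hps]
  have htgt : ∀ᶠ s : L in 𝓝 0, φ p + (s : F) ∈ φ.target := by
    have hc : ContinuousAt (fun s : L => φ p + (s : F)) 0 :=
      (continuous_const.add continuous_subtype_val).continuousAt
    refine hc.eventually (φ.open_target.eventually_mem ?_)
    simpa using φ.map_source hps
  have hψ : ∀ᶠ s in 𝓝 (0 : L), ContDiffAt ℝ ∞ ψ s ∧ ψ s ∈ V := by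
    filter_upwards [htgt] with s hs
    refine ⟨?_, ?_⟩
    · refine ContDiffAt.comp (g := φ.symm) s (h2.contDiffAt (φ.open_target.mem_nhds hs)) ?_
      exact contDiffAt_const.add L.subtypeL.contDiff.contDiffAt
    · rw [hL _ (φ.map_target hs), φ.right_inv hs]
      exact add_mem hpL s.2
  have hφd : HasFDerivAt φ (fderiv ℝ φ p) p :=
    ((h1.contDiffAt (φ.open_source.mem_nhds hps)).differentiableAt (by simp)).hasFDerivAt
  have hψd : HasFDerivAt ψ (fderiv ℝ ψ 0) 0 :=
    (hψ.self_of_nhds.1.differentiableAt (by simp)).hasFDerivAt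
  refine ⟨L, ψ, hψ0, hψ, ?_, ?_⟩
  · have e1 : HasFDerivAt (fun s => φ (ψ s)) ((fderiv ℝ φ p).comp (fderiv ℝ ψ 0)) 0 :=
      HasFDerivAt.comp (g := φ) 0 (by rw [hψ0]; exact hφd) hψd
    have e2 : HasFDerivAt (fun s : L => φ p + (s : F)) L.subtypeL 0 :=
      L.subtypeL.hasFDerivAt.const_add _
    have e3 : (fun s => φ (ψ s)) =ᶠ[𝓝 0] fun s : L => φ p + (s : F) := by
      filter_upwards [htgt] with s hs using φ.right_inv hs
    have e4 := e1.unique (e2.congr_of_eventuallyEq e3)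
    intro s t hst
    have e5 := congrArg (fun T : L →L[ℝ] F => T s) e4
    have e6 := congrArg (fun T : L →L[ℝ] F => T t) e4
    simp only [ContinuousLinearMap.comp_apply, hst] at e5 e6
    exact Subtype.ext (e5.symm.trans e6)
  · obtain ⟨π, hπ⟩ := L.subtype.exists_leftInverse_of_injective L.ker_subtype
    have hπ' : ∀ s : L, π s = s := fun s => congrArg (fun T : L →ₗ[ℝ] L => T s) hπ
    let π' : F →L[ℝ] L := LinearMap.toContinuousLinearMap π
    suffices tangent V p ≤ LinearMap.range (fderiv ℝ ψ 0 : L →ₗ[ℝ] F) from fun v hv => this hv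
    refine Submodule.span_le.2 ?_
    rintro v ⟨γ, -, h0, hd, hS⟩
    have hφγ : HasDerivAt (fun t => φ (γ t)) (fderiv ℝ φ p v) 0 :=
      HasFDerivAt.comp_hasDerivAt (l := φ) 0 (by rw [h0]; exact hφd) hd
    have hs : HasDerivAt (fun t => π' (φ (γ t) - φ p)) (π' (fderiv ℝ φ p v)) 0 :=
      π'.hasFDerivAt.comp_hasDerivAt 0 (hφγ.sub_const _)
    have hs' : HasDerivAt (fun t => ψ (π' (φ (γ t) - φ p)))
        (fderiv ℝ ψ 0 (π' (fderiv ℝ φ p v))) 0 :=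
      HasFDerivAt.comp_hasDerivAt (l := ψ) 0 (by simpa [h0] using hψd) hs
    have hlim : Tendsto γ (𝓝 0) (𝓝 p) := h0 ▸ hd.continuousAt.tendsto
    have heq : (fun t => ψ (π' (φ (γ t) - φ p))) =ᶠ[𝓝 0] γ := by
      filter_upwards [hS, hlim.eventually (φ.open_source.eventually_mem hps)] with t ht1 ht2
      have hmem : φ (γ t) - φ p ∈ L := sub_mem ((hL _ ht2).1 ht1) hpL
      have : ((π' (φ (γ t) - φ p) : L) : F) = φ (γ t) - φ p :=
        congrArg Subtype.val (hπ' ⟨_, hmem⟩)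
      show φ.symm (φ p + ((π' (φ (γ t) - φ p) : L) : F)) = γ t
      rw [this, add_sub_cancel, φ.left_inv ht2]
    exact ⟨_, hs'.unique (hd.congr_of_eventuallyEq heq)⟩

end Parametrization

/-! ### Transversality near the regular point and the holomorphic lift -/

section Continuity

variable {E A B Q : Type*} [NormedAddCommGroup E] [NormedSpace ℝ E] [NormedAddCommGroup A]
  [NormedSpace ℝ A] [NormedAddCommGroup B] [NormedSpace ℝ B] [TopologicalSpace Q]

theorem continuousAt_fderiv_clm_apply_add {D : E → A →L[ℝ] B} {f w : Q → E} {a : Q → A} {p : Q}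
    (hD : ContDiffAt ℝ ∞ D (f p)) (hf : ContinuousAt f p) (hw : ContinuousAt w p)
    (ha : ContinuousAt a p) (m : A) :
    ContinuousAt (fun q => fderiv ℝ D (f q) (w q) (a q) + D (f q) m) p := by
  have h1 : ContinuousAt (fun q => fderiv ℝ D (f q)) p :=
    ContinuousAt.comp (g := fderiv ℝ D) (hD.fderiv_right (m := ∞) (by simp)).continuousAt hf
  have h2 : ContinuousAt (fun q => D (f q)) p :=
    ContinuousAt.comp (g := D) hD.continuousAt hf
  exact ((h1.clm_apply hw).clm_apply ha).add (h2.clm_apply continuousAt_const)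

end Continuity

section Lift

variable {E : Type u} [NormedAddCommGroup E] [NormedSpace ℂ E] [FiniteDimensional ℂ E]
  {A : Type*} [NormedAddCommGroup A] [NormedSpace ℝ A] [FiniteDimensional ℝ A]

namespace IsGenericDefining

variable {S U : Set E} {r : E → A} {x : E} (h : IsGenericDefining S U r x)
include h

/-- Tangent vectors of the characteristic bundle extend continuously to nearby points. -/
theorem exists_tangent_extension {ξ : E →L[ℝ] ℝ} (hξ : (x, ξ) ∈ charBundle S)
    {Y : E × (E →L[ℝ] ℝ)} (hY : Y ∈ tangent (charBundle S) (x, ξ)) :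
    ∃ Z : E × (E →L[ℝ] ℝ) → E × (E →L[ℝ] ℝ), ContinuousAt Z (x, ξ) ∧ Z (x, ξ) = Y ∧
      ∀ᶠ q in 𝓝 (x, ξ), q ∈ charBundle S → Z q ∈ tangent (charBundle S) q := by
  have : FiniteDimensional ℝ E := FiniteDimensional.complexToReal E
  have hr : ∀ᶠ y in 𝓝 x, ContDiffAt ℝ ∞ r y := by
    filter_upwards [h.isOpen.mem_nhds h.mem] with y hy using h.contDiffAt hy
  have hD : ∀ᶠ y in 𝓝 x, ContDiffAt ℝ ∞ (dcMap r) y :=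
    hr.mono fun y hy => ContDiffAt.dcMap hy
  have hR : ∀ᶠ y in 𝓝 x, ContDiffAt ℝ ∞ (fderiv ℝ r) y :=
    hr.mono fun y hy => hy.fderiv_right (m := ∞) (by simp)
  obtain ⟨c, hc⟩ := exists_smooth_leftInverse hD (h.dcMap_injective h.mem)
  obtain ⟨G, hG⟩ := exists_smooth_rightInverse hR (h.surjective x h.mem)
  obtain ⟨l, rfl⟩ := h.exists_dcMap_of_mem_charBundle h.mem hξ
  obtain ⟨hY1, m, hY2⟩ := h.exists_of_mem_tangent_charBundle h.mem hY
  let w : E × (E →L[ℝ] ℝ) → E := fun q => Y.1 - G q.1 (fderiv ℝ r q.1 Y.1)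
  have hfst : ContinuousAt (fun q : E × (E →L[ℝ] ℝ) => q.1) (x, dcMap r x l) := continuousAt_fst
  have hw : ContinuousAt w (x, dcMap r x l) :=
    continuousAt_const.sub ((ContinuousAt.comp (g := G) hG.self_of_nhds.1.continuousAt hfst).clm_apply
      ((ContinuousAt.comp (g := fderiv ℝ r) hR.self_of_nhds.continuousAt hfst).clm_apply continuousAt_const))
  have hw0 : w (x, dcMap r x l) = Y.1 := by
    simp [w, h.fderiv_eq_zero h.mem hY1]
  refine ⟨fun q => (w q, fderiv ℝ (dcMap r) q.1 (w q) (c q.1 q.2) + dcMap r q.1 m), ?_, ?_, ?_⟩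
  · exact hw.prodMk (continuousAt_fderiv_clm_apply_add (f := Prod.fst) hD.self_of_nhds hfst hw
      ((ContinuousAt.comp (g := c) hc.self_of_nhds.1.continuousAt hfst).clm_apply
        continuousAt_snd) m)
  · refine Prod.ext hw0 ?_
    show fderiv ℝ (dcMap r) x (w (x, dcMap r x l)) (c x (dcMap r x l)) + dcMap r x m = Y.2
    rw [hw0, hc.self_of_nhds.2, hY2]
  · have hlim : Tendsto (fun q : E × (E →L[ℝ] ℝ) => q.1) (𝓝 (x, dcMap r x l)) (𝓝 x) :=
      continuousAt_fst
    filter_upwards [hlim.eventually hc, hlim.eventually hG,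
      hlim.eventually (h.isOpen.mem_nhds h.mem)] with q h1 h2 h3 h4
    obtain ⟨y, η⟩ := q
    change y ∈ U at h3
    obtain ⟨l', rfl⟩ := h.exists_dcMap_of_mem_charBundle h3 h4
    show (w (y, dcMap r y l'), fderiv ℝ (dcMap r) y (w (y, dcMap r y l')) (c y (dcMap r y l')) +
      dcMap r y m) ∈ tangent (charBundle S) (y, dcMap r y l')
    rw [h1.2]
    refine h.mem_tangent_charBundle h3 h4.1 ?_
    simp only [w, map_sub, h2.2, sub_self]

/-- If the annihilator `charAnn` meets a fixed subspace trivially at one point of the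
characteristic bundle, then it does so at nearby points. -/
theorem eventually_charAnn_disjoint {ξ : E →L[ℝ] ℝ} (hξ : (x, ξ) ∈ charBundle S)
    (K : Submodule ℝ (E × (E →L[ℝ] ℝ))) (hK : ∀ X ∈ K, X ∈ charAnn S (x, ξ) → X = 0) :
    ∀ᶠ q in 𝓝 (x, ξ), q ∈ charBundle S → ∀ X ∈ K, X ∈ charAnn S q → X = 0 := by
  have : FiniteDimensional ℝ E := FiniteDimensional.complexToReal E
  have : ProperSpace (E × (E →L[ℝ] ℝ)) := FiniteDimensional.proper ℝ _
  have hcpt : IsCompact (Metric.sphere (0 : E × (E →L[ℝ] ℝ)) 1 ∩ K) :=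
    (isCompact_sphere _ _).inter_right K.closed_of_finiteDimensional
  have key : ∀ᶠ q in 𝓝 (x, ξ), ∀ X ∈ Metric.sphere (0 : E × (E →L[ℝ] ℝ)) 1 ∩ K,
      q ∈ charBundle S → X ∉ charAnn S q := by
    refine hcpt.eventually_forall_of_forall_eventually fun X hX => ?_
    have hX0 : X ∉ charAnn S (x, ξ) := fun hX' => by
      have := hX.1
      rw [hK X hX.2 hX', mem_sphere_zero_iff_norm, norm_zero] at this
      exact zero_ne_one this
    have hX1 : ∃ Y ∈ tangent (charBundle S) (x, ξ),
        ¬(X.2 Y.1 = Y.2 X.1 ∧ X.2 (Complex.I • Y.1) = Y.2 (Complex.I • X.1)) := by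
      by_contra! hcon
      exact hX0 fun Y hY => ⟨(hcon Y hY).1, (hcon Y hY).2⟩
    obtain ⟨Y, hY, hne⟩ := hX1
    obtain ⟨Z, hZc, hZ0, hZ⟩ := h.exists_tangent_extension hξ hY
    have hlim : Tendsto (fun z : (E × (E →L[ℝ] ℝ)) × (E × (E →L[ℝ] ℝ)) => z.1)
        (𝓝 ((x, ξ), X)) (𝓝 (x, ξ)) := continuousAt_fst
    have hZ1 : ContinuousAt
        (fun z : (E × (E →L[ℝ] ℝ)) × (E × (E →L[ℝ] ℝ)) => Z z.1) ((x, ξ), X) :=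
      ContinuousAt.comp (g := Z) hZc hlim
    have hX2 : ContinuousAt
        (fun z : (E × (E →L[ℝ] ℝ)) × (E × (E →L[ℝ] ℝ)) => z.2) ((x, ξ), X) := continuousAt_snd
    have c1 : ContinuousAt (fun z : (E × (E →L[ℝ] ℝ)) × (E × (E →L[ℝ] ℝ)) =>
        z.2.2 (Z z.1).1 - (Z z.1).2 z.2.1) ((x, ξ), X) := (hX2.snd.clm_apply hZ1.fst).sub (hZ1.snd.clm_apply hX2.fst)
    have c2 : ContinuousAt (fun z : (E × (E →L[ℝ] ℝ)) × (E × (E →L[ℝ] ℝ)) =>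
        z.2.2 (Complex.I • (Z z.1).1) - (Z z.1).2 (Complex.I • z.2.1)) ((x, ξ), X) := (hX2.snd.clm_apply (hZ1.fst.const_smul Complex.I)).sub
      (hZ1.snd.clm_apply (hX2.fst.const_smul Complex.I))
    have hev : ∀ᶠ z in 𝓝 ((x, ξ), X), ¬(z.2.2 (Z z.1).1 = (Z z.1).2 z.2.1 ∧
        z.2.2 (Complex.I • (Z z.1).1) = (Z z.1).2 (Complex.I • z.2.1)) := by
      rw [not_and_or] at hne
      rcases hne with hne | hne
      · filter_upwards [c1.eventually_ne (by simp only [hZ0]; exact sub_ne_zero.2 hne)] with z hz hcon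
        exact hz (sub_eq_zero.2 hcon.1)
      · filter_upwards [c2.eventually_ne (by simp only [hZ0]; exact sub_ne_zero.2 hne)] with z hz hcon
        exact hz (sub_eq_zero.2 hcon.2)
    filter_upwards [hev, hlim.eventually hZ] with z h1 h2 h3 h4
    exact h1 (h4 _ (h2 h3))
  filter_upwards [key] with q hq hqS X hXK hX
  by_contra hne
  have hn : ‖X‖ ≠ 0 := norm_ne_zero_iff.2 hne
  refine hq (‖X‖⁻¹ • X) ⟨?_, K.smul_mem _ hXK⟩ hqS ((charAnn S q).smul_mem _ hX)
  rw [mem_sphere_zero_iff_norm, norm_smul, norm_inv, norm_norm, inv_mul_cancel₀ hn]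

/-- Near a regular point, the integral submanifold of the distribution `H_ξ H⁰S` is the graph of a
pair `(γ, ζ)` over an open subset of the Levi kernel `H`, and both components satisfy the
Cauchy–Riemann equations: the complex structure of `T*E` maps tangent vectors of the graph into
`charAnn`, which near the regular point contains no nonzero vector over the complement of `H`. -/
theorem exists_holomorphic_lift {ξ : E →L[ℝ] ℝ} {σ : E → E →L[ℝ] ℝ}
    (hσ : IsCharSection S x ξ σ) (hreg : IsRegularAt S (x, ξ)) (pr : E →L[ℂ] h.leviKer hσ)
    (hpr : ∀ v : h.leviKer hσ, pr v = v) :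
    ∃ (N : Set (h.leviKer hσ)) (γ : h.leviKer hσ → E) (ζ : h.leviKer hσ → E →L[ℝ] ℝ),
      IsOpen N ∧ pr x ∈ N ∧ γ (pr x) = x ∧ ζ (pr x) = ξ ∧
      ContDiffOn ℝ ∞ γ N ∧ ContDiffOn ℝ ∞ ζ N ∧
      ∀ s ∈ N, pr (γ s) = s ∧ γ s ∈ U ∧ (γ s, ζ s) ∈ charBundle S ∧
        (∀ u, fderiv ℝ γ s (Complex.I • u) = Complex.I • fderiv ℝ γ s u) ∧
        (∀ u, fderiv ℝ ζ s (Complex.I • u) = (fderiv ℝ ζ s u).comp (mulI E)) := by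
  have : FiniteDimensional ℝ E := FiniteDimensional.complexToReal E
  obtain ⟨d, V, hV, hpV, hVdot, hVH, hVp⟩ := hreg
  have hξ : (x, ξ) ∈ charBundle S := (hVdot hpV).1
  obtain ⟨L, ψ, hψ0, hψ, hinj, hsurj⟩ := hV.exists_param hpV
  let prR : E →L[ℝ] h.leviKer hσ := pr.restrictScalars ℝ
  let π : E × (E →L[ℝ] ℝ) →L[ℝ] h.leviKer hσ :=
    prR.comp (ContinuousLinearMap.fst ℝ E (E →L[ℝ] ℝ))
  have hψd : HasFDerivAt ψ (fderiv ℝ ψ 0) 0 :=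
    (hψ.self_of_nhds.1.differentiableAt (by simp)).hasFDerivAt
  have hπψ : ∀ᶠ s in 𝓝 (0 : L), ContDiffAt ℝ ∞ (fun s => π (ψ s)) s := by
    filter_upwards [hψ] with s hs using π.contDiff.contDiffAt.comp s hs.1
  have hπd : fderiv ℝ (fun s => π (ψ s)) 0 = π.comp (fderiv ℝ ψ 0) :=
    (π.hasFDerivAt.comp 0 hψd).fderiv
  have htan : ∀ s : L, fderiv ℝ ψ 0 s ∈ charH S (x, ξ) := by
    intro s
    rw [← hVp, ← hψ0]
    exact fderiv_mem_tangent hψ.self_of_nhds.1 (hψ.mono fun s hs => hs.2) s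
  have hker : ∀ X ∈ charAnn S (x, ξ), pr X.1 = 0 → X = 0 := by
    intro X hX hX1
    have h1 := h.fst_mem_leviKer_of_mem_charAnn hσ hX
    have h2 : pr X.1 = ⟨X.1, h1⟩ := hpr ⟨X.1, h1⟩
    rw [h2] at hX1
    exact h.eq_zero_of_mem_charAnn hσ hX (congrArg Subtype.val hX1)
  have hbij : Function.Bijective (fderiv ℝ (fun s => π (ψ s)) 0) := by
    rw [hπd]
    constructor
    · refine (injective_iff_map_eq_zero _).2 fun s hs => ?_
      have h0 := hker _ (h.charH_le_charAnn h.mem hξ (htan s)) hs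
      exact hinj (by rw [h0, map_zero])
    · intro v
      obtain ⟨X, hX, hXv⟩ := h.exists_mem_charH_of_mem_leviKer hσ v.2
      obtain ⟨s, hs⟩ := hsurj X (by rw [hVp]; exact hX)
      refine ⟨s, ?_⟩
      show pr (fderiv ℝ ψ 0 s).1 = v
      rw [hs, hXv, hpr]
  obtain ⟨g, hg0, hg⟩ := exists_smooth_local_rightInverse hπψ hbij
  have hx0 : π (ψ 0) = pr x := by rw [hψ0]; rfl
  rw [hx0] at hg0 hg
  let Ψ : h.leviKer hσ → E × (E →L[ℝ] ℝ) := fun s => ψ (g s)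
  have hΨ0 : Ψ (pr x) = (x, ξ) := by simp only [Ψ, hg0, hψ0]
  have hlim : Tendsto g (𝓝 (pr x)) (𝓝 0) := by
    have := hg.self_of_nhds.1.continuousAt.tendsto
    rwa [hg0] at this
  have hΨ : ∀ᶠ s in 𝓝 (pr x), ContDiffAt ℝ ∞ Ψ s ∧ Ψ s ∈ V ∧ pr (Ψ s).1 = s := by
    filter_upwards [hg, hlim.eventually hψ] with s h1 h2
    exact ⟨h2.1.comp s h1.1, h2.2, h1.2⟩
  have hΨc : Tendsto Ψ (𝓝 (pr x)) (𝓝 (x, ξ)) := by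
    have := hΨ.self_of_nhds.1.continuousAt.tendsto
    rwa [hΨ0] at this
  let K : Submodule ℝ (E × (E →L[ℝ] ℝ)) :=
    LinearMap.ker (π : E × (E →L[ℝ] ℝ) →ₗ[ℝ] h.leviKer hσ)
  have hdisj := hΨc.eventually
    (h.eventually_charAnn_disjoint hξ K fun X hXK hX => hker X hX hXK)
  have hU : ∀ᶠ s in 𝓝 (pr x), (Ψ s).1 ∈ U :=
    (continuousAt_fst.tendsto.comp hΨc).eventually (h.isOpen.mem_nhds h.mem)
  obtain ⟨N, hN, hNo, hxN⟩ := eventually_nhds_iff.1 (hΨ.and (hdisj.and hU))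
  have hCR : ∀ s ∈ N, ∀ u, fderiv ℝ Ψ s (Complex.I • u) = cotJ (fderiv ℝ Ψ s u) := by
    intro s hs u
    obtain ⟨⟨h1, h2, h3⟩, h4, h5⟩ := hN s hs
    have hqS : Ψ s ∈ charBundle S := (hVdot h2).1
    have htan' : ∀ u, fderiv ℝ Ψ s u ∈ charAnn S (Ψ s) := fun u =>
      h.charH_le_charAnn h5 hqS (hVH _ h2 (fderiv_mem_tangent h1
        (eventually_of_mem (hNo.mem_nhds hs) fun s' hs' => (hN s' hs').1.2.1) u))
    have hprd : ∀ u, pr (fderiv ℝ Ψ s u).1 = u := by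
      intro u
      have e1 : HasFDerivAt (fun s => π (Ψ s)) (π.comp (fderiv ℝ Ψ s)) s :=
        π.hasFDerivAt.comp s (h1.differentiableAt (by simp)).hasFDerivAt
      have e2 : (fun s => π (Ψ s)) =ᶠ[𝓝 s] id :=
        eventually_of_mem (hNo.mem_nhds hs) fun s' hs' => (hN s' hs').1.2.2
      exact congrArg (fun T : h.leviKer hσ →L[ℝ] h.leviKer hσ => T u)
        (e1.unique ((hasFDerivAt_id s).congr_of_eventuallyEq e2))
    rw [← sub_eq_zero]
    refine h4 hqS _ ?_ (sub_mem (htan' _) (cotJ_mem_charAnn (htan' u)))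
    show pr ((fderiv ℝ Ψ s (Complex.I • u)).1 - Complex.I • (fderiv ℝ Ψ s u).1) = 0
    rw [map_sub, hprd, map_smul pr, hprd, sub_self]
  have hd1 : ∀ s ∈ N, fderiv ℝ (fun s => (Ψ s).1) s =
      (ContinuousLinearMap.fst ℝ E (E →L[ℝ] ℝ)).comp (fderiv ℝ Ψ s) := fun s hs =>
    ((ContinuousLinearMap.fst ℝ E (E →L[ℝ] ℝ)).hasFDerivAt.comp s
      ((hN s hs).1.1.differentiableAt (by simp)).hasFDerivAt).fderiv
  have hd2 : ∀ s ∈ N, fderiv ℝ (fun s => (Ψ s).2) s =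
      (ContinuousLinearMap.snd ℝ E (E →L[ℝ] ℝ)).comp (fderiv ℝ Ψ s) := fun s hs =>
    ((ContinuousLinearMap.snd ℝ E (E →L[ℝ] ℝ)).hasFDerivAt.comp s
      ((hN s hs).1.1.differentiableAt (by simp)).hasFDerivAt).fderiv
  refine ⟨N, fun s => (Ψ s).1, fun s => (Ψ s).2, hNo, hxN, congrArg Prod.fst hΨ0,
    congrArg Prod.snd hΨ0,
    fun s hs => (hN s hs).1.1.fst.contDiffWithinAt,
    fun s hs => (hN s hs).1.1.snd.contDiffWithinAt, fun s hs => ?_⟩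
  obtain ⟨⟨h1, h2, h3⟩, h4, h5⟩ := hN s hs
  refine ⟨h3, h5, (hVdot h2).1, fun u => ?_, fun u => ?_⟩
  · rw [hd1 s hs]
    exact congrArg Prod.fst (hCR s hs u)
  · rw [hd2 s hs]
    exact congrArg Prod.snd (hCR s hs u)

end IsGenericDefining

end Lift

/-! ### Straightening the complex submanifold -/

section NormalForm

variable {E : Type*} [NormedAddCommGroup E] [NormedSpace ℂ E]

variable (E) in
/-- The `(1,0)`-form `v ↦ (ξ(iv) + i ξ(v)) / 2` of a real covector `ξ`. For `ξ = d^c ρ` it is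
`∂ρ`. -/
def dcPart10 : (E →L[ℝ] ℝ) →L[ℝ] (E →L[ℂ] ℂ) :=
  LinearMap.mkContinuous
    { toFun := fun ξ => Complex.I • holPart (Complex.ofRealCLM.comp ξ)
      map_add' := fun ξ η => by
        rw [ContinuousLinearMap.comp_add, map_add, smul_add]
      map_smul' := fun c ξ => by
        rw [ContinuousLinearMap.comp_smul, map_smul, smul_comm, RingHom.id_apply] }
    ‖(holPart : (E →L[ℝ] ℂ) →L[ℝ] (E →L[ℂ] ℂ))‖ (fun ξ => by
      have h1 : ‖Complex.ofRealCLM.comp ξ‖ ≤ ‖ξ‖ := by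
        simpa using Complex.ofRealCLM.opNorm_comp_le ξ
      have h2 := (holPart : (E →L[ℝ] ℂ) →L[ℝ] (E →L[ℂ] ℂ)).le_opNorm (Complex.ofRealCLM.comp ξ)
      have h3 := mul_le_mul_of_nonneg_left h1
        (norm_nonneg (holPart : (E →L[ℝ] ℂ) →L[ℝ] (E →L[ℂ] ℂ)))
      simp only [LinearMap.coe_mk, AddHom.coe_mk, norm_smul, Complex.norm_I, one_mul]
      exact h2.trans h3)

theorem dcPart10_apply (ξ : E →L[ℝ] ℝ) (v : E) :
    dcPart10 E ξ v = ((ξ (Complex.I • v) : ℂ) + Complex.I * (ξ v : ℂ)) / 2 := by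
  show Complex.I • ((1 / 2 : ℂ) • ((ξ v : ℂ) - Complex.I • (ξ (Complex.I • v) : ℂ))) = _
  simp only [smul_eq_mul]
  linear_combination (-(ξ (Complex.I • v) : ℂ) / 2) * Complex.I_sq

theorem dcPart10_comp_mulI (ξ : E →L[ℝ] ℝ) :
    dcPart10 E (ξ.comp (mulI E)) = Complex.I • dcPart10 E ξ := by
  ext v
  rw [smul_apply, dcPart10_apply, dcPart10_apply]
  simp only [ContinuousLinearMap.comp_apply, mulI_apply, I_smul_I_smul, map_neg, smul_eq_mul]
  push_cast
  linear_combination (-(ξ v : ℂ) / 2) * Complex.I_sq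

/-- The shear `y ↦ y - (γ(π y) - π y)`, which straightens the graph `γ(N)` of a map `N → E` with
`π ∘ γ = id` to the subspace on which it is defined. -/
def shear {H : Submodule ℂ E} (pr : E →L[ℂ] H) (hpr : ∀ v : H, pr v = v) (N : Set H)
    (hN : IsOpen N) (γ : H → E) (hγ : ContinuousOn γ N) (hγpr : ∀ s ∈ N, pr (γ s) = s) :
    OpenPartialHomeomorph E E where
  toFun y := y - (γ (pr y) - pr y)
  invFun y := y + (γ (pr y) - pr y)
  source := pr ⁻¹' N
  target := pr ⁻¹' N
  map_source' y hy := by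
    have : pr y ∈ N := hy
    simpa [hpr, hγpr _ this] using this
  map_target' y hy := by
    have : pr y ∈ N := hy
    simpa [hpr, hγpr _ this] using this
  left_inv' y hy := by
    have : pr y ∈ N := hy
    simp [hpr, hγpr _ this]
  right_inv' y hy := by
    have : pr y ∈ N := hy
    simp [hpr, hγpr _ this]
  open_source := hN.preimage pr.continuous
  open_target := hN.preimage pr.continuous
  continuousOn_toFun := continuousOn_id.sub
    ((hγ.comp pr.continuous.continuousOn fun _ h => h).sub
      (continuous_subtype_val.comp pr.continuous).continuousOn)
  continuousOn_invFun := continuousOn_id.add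
    ((hγ.comp pr.continuous.continuousOn fun _ h => h).sub
      (continuous_subtype_val.comp pr.continuous).continuousOn)

end NormalForm

section Local

variable {E : Type u} [NormedAddCommGroup E] [NormedSpace ℂ E] [FiniteDimensional ℂ E]
  {A : Type*} [NormedAddCommGroup A] [NormedSpace ℝ A] [FiniteDimensional ℝ A]

/-- The theorem in a coordinate space: `Φ` is a holomorphic chart straightening the complex
submanifold `Φ⁻¹(H)` of `S`, and the holomorphic map `Z` agrees on it with `∂ρ`. The function `ρ`
is `∑ λ_j ρ_j` with smooth coefficients `λ_j` that are the coordinates of the integral submanifold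
of the characteristic bundle. -/
theorem IsGenericDefining.exists_normalForm {S U : Set E} {r : E → A} {x : E}
    (h : IsGenericDefining S U r x) {ξ : E →L[ℝ] ℝ} (hreg : IsRegularAt S (x, ξ)) {n m : ℕ}
    (hm : HasLeviRank n S x ξ m) :
    ∃ (H : Submodule ℂ E) (Φ : OpenPartialHomeomorph E E) (ρ : E → ℝ) (Z : E → E →L[ℂ] ℂ),
      Module.finrank ℂ H = n - m ∧ x ∈ Φ.source ∧ ContDiffOn ℂ ∞ Φ Φ.source ∧
      ContDiffOn ℂ ∞ Φ.symm Φ.target ∧ Φ x ∈ H ∧ ContDiffOn ℝ ∞ ρ Φ.source ∧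
      DifferentiableOn ℂ Z Φ.source ∧ (∀ y ∈ Φ.source, y ∈ S → ρ y = 0) ∧
      (∀ v, dc (fderiv ℝ ρ x) v = ((ξ v : ℝ) : ℂ)) ∧
      ∀ y ∈ Φ.source, Φ y ∈ H → y ∈ S ∧ ∀ v, part10 (fderiv ℝ ρ y) v = Z y v := by
  have : FiniteDimensional ℝ E := FiniteDimensional.complexToReal E
  obtain ⟨σ, hσ, b, hb⟩ := hm
  obtain ⟨pr₀, hpr₀⟩ := (h.leviKer hσ).subtype.exists_leftInverse_of_injective
    (h.leviKer hσ).ker_subtype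
  let pr : E →L[ℂ] h.leviKer hσ := LinearMap.toContinuousLinearMap pr₀
  have hpr : ∀ v : h.leviKer hσ, pr v = v := fun v =>
    congrArg (fun T : h.leviKer hσ →ₗ[ℂ] h.leviKer hσ => T v) hpr₀
  obtain ⟨N₀, γ, ζ, hN₀, hxN₀, hγx, hζx, hγ₀, hζ₀, hlift₀⟩ :=
    h.exists_holomorphic_lift hσ hreg pr hpr
  -- `c` recovers the coordinates of a characteristic covector.
  have hD : ∀ᶠ y in 𝓝 x, ContDiffAt ℝ ∞ (dcMap r) y := by
    filter_upwards [h.isOpen.mem_nhds h.mem] with y hy using ContDiffAt.dcMap (h.contDiffAt hy)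
  obtain ⟨c, hc⟩ := exists_smooth_leftInverse hD (h.dcMap_injective h.mem)
  have hγc : Tendsto γ (𝓝 (pr x)) (𝓝 x) := by
    have := (hγ₀.contDiffAt (hN₀.mem_nhds hxN₀)).continuousAt.tendsto
    rwa [hγx] at this
  obtain ⟨N, hNsub, hN, hxN⟩ :=
    eventually_nhds_iff.1 ((hN₀.eventually_mem hxN₀).and (hγc.eventually hc))
  have hlift := fun s hs => hlift₀ s (hNsub s hs).1
  have hγ : ContDiffOn ℝ ∞ γ N := hγ₀.mono fun s hs => (hNsub s hs).1
  have hζ : ContDiffOn ℝ ∞ ζ N := hζ₀.mono fun s hs => (hNsub s hs).1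
  have hγC : ContDiffOn ℂ ∞ γ N :=
    contDiffOn_complex_of_real hN hγ fun s hs => (hlift s hs).2.2.2.1
  let Φ₀ := shear pr hpr N hN γ hγ.continuousOn fun s hs => (hlift s hs).1
  let Φ := Φ₀.restrOpen U h.isOpen
  have hsrc : ∀ y, y ∈ Φ.source ↔ pr y ∈ N ∧ y ∈ U := fun y => Iff.rfl
  let l : h.leviKer hσ → A →L[ℝ] ℝ := fun s => c (γ s) (ζ s)
  let ρ : E → ℝ := fun y => l (pr y) (r y)
  let prR : E →L[ℝ] h.leviKer hσ := pr.restrictScalars ℝ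
  have hl : ∀ s ∈ N, ContDiffAt ℝ ∞ l s := fun s hs =>
    (ContDiffAt.comp (g := c) s (hNsub s hs).2.1 (hγ.contDiffAt (hN.mem_nhds hs))).clm_apply
      (hζ.contDiffAt (hN.mem_nhds hs))
  have hlpr : ∀ y, pr y ∈ N → ContDiffAt ℝ ∞ (fun y => l (pr y)) y := fun y hy =>
    ContDiffAt.comp (g := l) y (hl _ hy) prR.contDiff.contDiffAt
  -- Points of the straightened set are of the form `γ s`.
  have hgraph : ∀ y ∈ Φ.source, Φ y ∈ h.leviKer hσ → γ (pr y) = y := by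
    intro y hy hyH
    have hyN := ((hsrc y).1 hy).1
    have e0 : Φ y = y - (γ (pr y) - pr y) := rfl
    have e1 : pr (Φ y) = pr y := by
      rw [e0, map_sub, map_sub, hpr, (hlift _ hyN).1, sub_self, sub_zero]
    have e2 : ((pr (Φ y) : h.leviKer hσ) : E) = Φ y := congrArg Subtype.val (hpr ⟨Φ y, hyH⟩)
    rw [e1, e0] at e2
    have e3 : y - γ (pr y) = 0 := by
      have : y - γ (pr y) = y - (γ (pr y) - pr y) - pr y := by abel
      rw [this, ← e2, sub_self]
    exact (sub_eq_zero.1 e3).symm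
  have hdρ : ∀ y ∈ Φ.source, Φ y ∈ h.leviKer hσ → y ∈ S ∧
      ∀ v, fderiv ℝ ρ y v = ζ (pr y) (Complex.I • v) ∧
        fderiv ℝ ρ y (Complex.I • v) = -ζ (pr y) v := by
    intro y hy hyH
    obtain ⟨hyN, hyU⟩ := (hsrc y).1 hy
    have hyγ := hgraph y hy hyH
    have hchar := (hlift _ hyN).2.2.1
    rw [hyγ] at hchar
    have hyS : y ∈ S := hchar.1
    obtain ⟨l', hl'⟩ := h.exists_dcMap_of_mem_charBundle hyU hchar
    have hll' : l (pr y) = l' := by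
      have := (hNsub _ hyN).2.2 l'
      rw [hyγ, ← hl'] at this
      simp only [l, hyγ, this]
    have hfd : ∀ v, fderiv ℝ ρ y v = l' (fderiv ℝ r y v) := by
      intro v
      have e1 := ((hlpr y hyN).differentiableAt (by simp)).hasFDerivAt.clm_apply
        ((h.contDiffAt hyU).differentiableAt (by simp)).hasFDerivAt
      rw [show fderiv ℝ ρ y = _ from e1.fderiv]
      simp [(h.mem_iff y hyU).1 hyS, hll']
    refine ⟨hyS, fun v => ⟨?_, ?_⟩⟩
    · rw [hfd, hl', dcMap_apply_I]
    · rw [hfd, hl', dcMap_apply, neg_neg]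
  have hxsrc : x ∈ Φ.source := (hsrc x).2 ⟨hxN, h.mem⟩
  have hΦx : Φ x ∈ h.leviKer hσ := by
    have : Φ x = pr x := by
      show x - (γ (pr x) - pr x) = pr x
      rw [hγx]; abel
    rw [this]
    exact (pr x).2
  have hζd : ∀ s ∈ N, DifferentiableAt ℂ (fun s => dcPart10 E (ζ s)) s := by
    intro s hs
    have hd := (hζ.contDiffAt (hN.mem_nhds hs)).differentiableAt (by simp)
    have hd' : HasFDerivAt (fun s => dcPart10 E (ζ s)) ((dcPart10 E).comp (fderiv ℝ ζ s)) s :=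
      (dcPart10 E).hasFDerivAt.comp s hd.hasFDerivAt
    refine (hasFDerivAt_holPart hd'.differentiableAt fun u => ?_).differentiableAt
    rw [hd'.fderiv, ContinuousLinearMap.comp_apply, (hlift s hs).2.2.2.2 u, dcPart10_comp_mulI]
    rfl
  have hγpr : ContDiffOn ℂ ∞ (fun y => γ (pr y) - pr y) (pr ⁻¹' N) :=
    (hγC.comp pr.contDiff.contDiffOn fun _ hy => hy).sub
      ((h.leviKer hσ).subtypeL.contDiff.comp pr.contDiff).contDiffOn
  refine ⟨h.leviKer hσ, Φ, ρ, fun y => dcPart10 E (ζ (pr y)), h.finrank_leviKer hσ b hb, hxsrc,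
    ?_, ?_, hΦx, ?_, ?_, ?_, fun v => ?_, fun y hy hyH => ⟨(hdρ y hy hyH).1, fun v => ?_⟩⟩
  · exact contDiffOn_id.sub (hγpr.mono fun y hy => ((hsrc y).1 hy).1)
  · exact contDiffOn_id.add (hγpr.mono fun y hy => hy.1)
  · intro y hy
    obtain ⟨hyN, hyU⟩ := (hsrc y).1 hy
    exact ((hlpr y hyN).clm_apply (h.contDiffAt hyU)).contDiffWithinAt
  · intro y hy
    exact (DifferentiableAt.comp (g := fun s => dcPart10 E (ζ s)) y (hζd _ ((hsrc y).1 hy).1)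
      pr.differentiableAt).differentiableWithinAt
  · intro y hy hyS
    simp only [ρ, (h.mem_iff y ((hsrc y).1 hy).2).1 hyS, map_zero]
  · rw [dc_eq, ((hdρ x hxsrc hΦx).2 v).2, hζx, neg_neg]
  · rw [part10, ((hdρ y hy hyH).2 v).1, ((hdρ y hy hyH).2 v).2, dcPart10_apply]
    push_cast
    ring

end Local

/-! ### Charts and coordinate changes -/

section Atlas

variable {𝕜 E : Type*} [NontriviallyNormedField 𝕜] [NormedAddCommGroup E] [NormedSpace 𝕜 E]
  {X : Type*} [TopologicalSpace X] [ChartedSpace E X]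

theorem mem_contDiffGroupoid_self {e : OpenPartialHomeomorph E E} :
    e ∈ contDiffGroupoid ∞ 𝓘(𝕜, E) ↔
      ContDiffOn 𝕜 ∞ e e.source ∧ ContDiffOn 𝕜 ∞ e.symm e.target := by
  rw [contDiffGroupoid, mem_groupoid_of_pregroupoid]
  simp [contDiffPregroupoid]

/-- Composing a chart with a local diffeomorphism of the model space gives a chart. -/
theorem trans_mem_maximalAtlas [IsManifold 𝓘(𝕜, E) ∞ X] {e : OpenPartialHomeomorph X E}
    (he : e ∈ IsManifold.maximalAtlas 𝓘(𝕜, E) ∞ X) {Φ : OpenPartialHomeomorph E E}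
    (h1 : ContDiffOn 𝕜 ∞ Φ Φ.source) (h2 : ContDiffOn 𝕜 ∞ Φ.symm Φ.target) :
    e ≫ₕ Φ ∈ IsManifold.maximalAtlas 𝓘(𝕜, E) ∞ X := by
  have hΦ : Φ ∈ contDiffGroupoid ∞ 𝓘(𝕜, E) := mem_contDiffGroupoid_self.2 ⟨h1, h2⟩
  refine mem_maximalAtlas_iff.2 fun e' he' => ⟨?_, ?_⟩
  · rw [OpenPartialHomeomorph.trans_symm_eq_symm_trans_symm, OpenPartialHomeomorph.trans_assoc]
    exact StructureGroupoid.trans _ (StructureGroupoid.symm _ hΦ) (he e' he').1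
  · rw [← OpenPartialHomeomorph.trans_assoc]
    exact StructureGroupoid.trans _ (he e' he').2 hΦ

end Atlas

/-! ### Passage from the manifold to a chart -/

section RealStructure

variable {E : Type*} [NormedAddCommGroup E] [NormedSpace ℂ E]
  {X : Type*} [TopologicalSpace X] [ChartedSpace E X]

/-- The smooth real manifold underlying a complex manifold. -/
theorem isManifold_real_of_complex [IsManifold 𝓘(ℂ, E) ∞ X] : IsManifold 𝓘(ℝ, E) ∞ X := by
  refine isManifold_of_contDiffOn _ _ _ fun e e' he he' => ?_
  have := (mem_contDiffGroupoid_self.1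
    (StructureGroupoid.compatible (contDiffGroupoid ∞ 𝓘(ℂ, E)) he he')).1
  simpa using this.restrict_scalars ℝ

/-- At `x`, the differential of a function is its derivative in the preferred chart at `x`. -/
theorem dR_eq_fderiv {ρ : X → ℝ} {x : X} (hρ : MDifferentiableAt 𝓘(ℝ, E) 𝓘(ℝ, ℝ) ρ x) :
    (dR E ρ x : E →L[ℝ] ℝ) = fderiv ℝ (ρ ∘ (chartAt E x).symm) (chartAt E x x) := by
  unfold dR
  rw [hρ.mfderiv]
  simp [writtenInExtChartAt, fderivWithin_univ]
  rfl

theorem part10_comp (l : E →L[ℝ] ℝ) (B : E →L[ℂ] E) (v : E) :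
    part10 (l.comp (B.restrictScalars ℝ)) v = part10 l (B v) := by
  simp [part10]

/-- If the `(1,0)`-parts of real covectors `δ_j` are linearly independent over `ℂ`, then the
covectors `δ_j` and `δ_j ∘ i` are linearly independent over `ℝ`: a relation with coefficients
`a_j`, `b_j` yields one for the `(1,0)`-parts with coefficients `a_j + i b_j`. -/
theorem eq_zero_of_linearIndependent_part10 {ι : Type*} [Fintype ι] {δ : ι → E →L[ℝ] ℝ}
    (hind : LinearIndependent ℂ (fun j => (part10 (δ j) : E → ℂ))) {a b : ι → ℝ}
    (h : ∀ v, ∑ j, (a j * δ j v + b j * δ j (Complex.I • v)) = 0) :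
    (∀ j, a j = 0) ∧ ∀ j, b j = 0 := by
  have hzero := Fintype.linearIndependent_iff.1 hind (fun j => (a j : ℂ) + Complex.I * (b j : ℂ))
    (by
      ext v
      have h1 := congrArg (fun t : ℝ => (t : ℂ)) (h v)
      have h2 := congrArg (fun t : ℝ => (t : ℂ)) (h (Complex.I • v))
      simp only [I_smul_I_smul, map_neg] at h2
      push_cast at h1 h2
      rw [Finset.sum_apply, Pi.zero_apply]
      have h3 : (1 / 2 : ℂ) * (∑ j, ((a j : ℂ) * (δ j v : ℂ) +
            (b j : ℂ) * (δ j (Complex.I • v) : ℂ)))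
          - (Complex.I / 2) * (∑ j, ((a j : ℂ) * (δ j (Complex.I • v) : ℂ) +
            (b j : ℂ) * -(δ j v : ℂ))) = 0 := by
        rw [h1, h2]; ring
      rw [← h3, Finset.mul_sum, Finset.mul_sum, ← Finset.sum_sub_distrib]
      refine Finset.sum_congr rfl fun j _ => ?_
      simp only [Pi.smul_apply, smul_eq_mul, part10]
      linear_combination (-(b j : ℂ) * (δ j (Complex.I • v) : ℂ) / 2) * Complex.I_sq)
  refine ⟨fun j => ?_, fun j => ?_⟩
  · simpa using congrArg Complex.re (hzero j)
  · simpa using congrArg Complex.im (hzero j)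

/-- A generic `CR` submanifold, read in the preferred chart at one of its points. -/
theorem IsGenericCR.exists_isGenericDefining [FiniteDimensional ℂ E]
    [IsManifold 𝓘(ℂ, E) ∞ X] {k : ℕ} {M : Set X}
    (hM : IsGenericCR E k M) {x : X} (hx : x ∈ M) :
    ∃ (U : Set E) (r : E → Fin k → ℝ), U ⊆ (chartAt E x).target ∧
      IsGenericDefining (chartImage E M x) U r (chartAt E x x) := by
  have : FiniteDimensional ℝ E := FiniteDimensional.complexToReal E
  have : IsManifold 𝓘(ℝ, E) ∞ X := isManifold_real_of_complex
  obtain ⟨O, hO, hxO, ρ, hρ, hρM, hind⟩ := hM x hx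
  set e := chartAt E x with he
  have hxe : x ∈ e.source := mem_chart_source E x
  let r : E → Fin k → ℝ := fun y j => ρ j (e.symm y)
  let U₀ : Set E := e.target ∩ e.symm ⁻¹' O
  have hU₀ : IsOpen U₀ := e.isOpen_inter_preimage_symm hO
  have hxU₀ : e x ∈ U₀ := ⟨e.map_source hxe, by simpa [e.left_inv hxe] using hxO⟩
  have hρe : ∀ j, ContDiffOn ℝ ∞ (ρ j ∘ e.symm) U₀ := fun j =>
    contMDiffOn_iff_contDiffOn.1 ((hρ j).comp
      ((contMDiffOn_chart_symm (I := 𝓘(ℝ, E)) (x := x)).mono inter_subset_left)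
      fun y hy => hy.2)
  have hr : ContDiffOn ℝ ∞ r U₀ := contDiffOn_pi.2 hρe
  have hrx : ∀ y ∈ U₀, ContDiffAt ℝ ∞ r y := fun y hy => hr.contDiffAt (hU₀.mem_nhds hy)
  have hind' : LinearIndependent ℂ
      (fun j => (part10 (fderiv ℝ (ρ j ∘ e.symm) (e x)) : E → ℂ)) := by
    convert hind x hxO using 3 with j
    exact congrArg (part10 (E := E)) (dR_eq_fderiv
      (((hρ j).contMDiffAt (hO.mem_nhds hxO)).mdifferentiableAt (by simp))).symm
  have hdr : ∀ j v, fderiv ℝ r (e x) v j = fderiv ℝ (ρ j ∘ e.symm) (e x) v := by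
    intro j v
    have hd : ∀ i, DifferentiableAt ℝ (fun y => r y i) (e x) := fun i =>
      ((hρe i).contDiffAt (hU₀.mem_nhds hxU₀)).differentiableAt (by simp)
    rw [show fderiv ℝ r (e x) = _ from fderiv_pi hd]
    rfl
  have hgen : ∀ l m : (Fin k → ℝ) →L[ℝ] ℝ,
      (∀ v, l (fderiv ℝ r (e x) v) + m (fderiv ℝ r (e x) (Complex.I • v)) = 0) →
        l = 0 ∧ m = 0 := by
    intro l m hlm
    have hsum : ∀ (l : (Fin k → ℝ) →L[ℝ] ℝ) (a : Fin k → ℝ),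
        l a = ∑ j, l (Pi.single j 1) * a j := by
      intro l a
      conv_lhs => rw [pi_eq_sum_univ' a, map_sum]
      refine Finset.sum_congr rfl fun j _ => ?_
      rw [map_smul, smul_eq_mul, mul_comm]
    obtain ⟨hl, hm⟩ := eq_zero_of_linearIndependent_part10 hind'
      (a := fun j => l (Pi.single j 1)) (b := fun j => m (Pi.single j 1)) (fun v => by
        have := hlm v
        rw [hsum l, hsum m, ← Finset.sum_add_distrib] at this
        simpa only [hdr] using this)
    constructor
    · ext a; rw [hsum]; simp [hl]
    · ext a; rw [hsum]; simp [hm]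
  have hsurj : Function.Surjective (fderiv ℝ r (e x)) := by
    refine (LinearMap.range_eq_top (f := (fderiv ℝ r (e x) : E →ₗ[ℝ] Fin k → ℝ))).1 ?_
    by_contra hne
    obtain ⟨f, hf0, hf⟩ := Submodule.exists_le_ker_of_lt_top _ (lt_top_iff_ne_top.2 hne)
    have := (hgen (LinearMap.toContinuousLinearMap f) 0 fun v => by
      simpa using hf ⟨v, rfl⟩).1
    refine hf0 (LinearMap.ext fun a => ?_)
    exact congrArg (fun T : (Fin k → ℝ) →L[ℝ] ℝ => T a) this
  obtain ⟨G, hG⟩ := exists_smooth_rightInverse (R := fderiv ℝ r) (x := e x)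
    (by filter_upwards [hU₀.mem_nhds hxU₀] with y hy
        exact (hrx y hy).fderiv_right (m := ∞) (by simp)) hsurj
  obtain ⟨U, hUsub, hU, hxU⟩ :=
    eventually_nhds_iff.1 ((hU₀.eventually_mem hxU₀).and hG)
  refine ⟨U, r, fun y hy => (hUsub y hy).1.1, hU, hxU, ⟨x, ⟨hx, hxe⟩, rfl⟩,
    hr.mono fun y hy => (hUsub y hy).1, fun y hy => ?_, fun y hy a => ⟨_, (hUsub y hy).2.2 a⟩, hgen⟩
  obtain ⟨⟨hyt, hyO⟩, -⟩ := hUsub y hy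
  have h1 : y ∈ chartImage E M x ↔ e.symm y ∈ M := by
    constructor
    · rintro ⟨q, ⟨hqM, hqe⟩, rfl⟩
      rwa [← he, e.left_inv hqe]
    · exact fun h => ⟨e.symm y, ⟨h, e.map_target hyt⟩, e.right_inv hyt⟩
  rw [h1, hρM _ hyO]
  exact funext_iff.symm

/-- If `∂ρ` agrees along `W` with a holomorphic map in one chart, then the complex derivatives of
`ρ` in every holomorphic chart are holomorphic along `W`. -/
theorem holomorphicAlong_dz [IsManifold 𝓘(ℂ, E) ∞ X] {e φ : OpenPartialHomeomorph X E}
    (he : e ∈ IsManifold.maximalAtlas 𝓘(ℂ, E) ∞ X) (hφ : φ ∈ IsManifold.maximalAtlas 𝓘(ℂ, E) ∞ X)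
    {O : Set E} (hO : IsOpen O) {W : Set X} (hW : W ⊆ e.source ∩ e ⁻¹' O)
    {ρ : E → ℝ} {Z : E → E →L[ℂ] ℂ} (hρ : ∀ y ∈ O, DifferentiableAt ℝ ρ y)
    (hZ : DifferentiableOn ℂ Z O)
    (h : ∀ q ∈ W, ∀ v, part10 (fderiv ℝ ρ (e q)) v = Z (e q) v) (v : E) :
    HolomorphicAlong E (dz φ (ρ ∘ e) v) (W ∩ φ.source) := by
  have hτ := (mem_contDiffGroupoid_self.1
    (StructureGroupoid.compatible_of_mem_maximalAtlas hφ he)).1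
  set τ := φ.symm ≫ₕ e
  have hτe : ∀ q ∈ φ.source, τ (φ q) = e q := fun q hq => by
    simp [τ, φ.left_inv hq]
  have hτs : ∀ q ∈ φ.source, q ∈ e.source → φ q ∈ τ.source := fun q hq hqe => by
    simp [τ, φ.left_inv hq, φ.map_source hq, hqe]
  have hτd : ∀ y ∈ τ.source, DifferentiableAt ℂ τ y := fun y hy =>
    (hτ.contDiffAt (τ.open_source.mem_nhds hy)).differentiableAt (by simp)
  have hτd' : ∀ y ∈ τ.source, DifferentiableAt ℂ (fderiv ℂ τ) y := fun y hy =>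
    ((hτ.contDiffAt (τ.open_source.mem_nhds hy)).fderiv_right (m := ∞)
      (by simp)).differentiableAt (by simp)
  let g : E → ℂ := fun y => Z (τ y) (fderiv ℂ τ y v)
  have hg : ∀ y ∈ τ.source, τ y ∈ O → DifferentiableAt ℂ g y := by
    intro y hy hyO
    exact (DifferentiableAt.comp (g := Z) y (hZ.differentiableAt (hO.mem_nhds hyO))
      (hτd y hy)).clm_apply ((hτd' y hy).clm_apply (differentiableAt_const v))
  intro p hp
  refine ⟨φ.source ∩ (e.source ∩ e ⁻¹' O), φ.open_source.inter (e.isOpen_inter_preimage hO),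
    ⟨hp.2, hW hp.1⟩, g ∘ φ, ?_, ?_⟩
  · intro q hq
    have h1 : MDifferentiableAt 𝓘(ℂ, E) 𝓘(ℂ, ℂ) g (φ q) :=
      (hg _ (hτs q hq.1 hq.2.1) (by rw [hτe q hq.1]; exact hq.2.2)).mdifferentiableAt
    have h2 : MDifferentiableAt 𝓘(ℂ, E) 𝓘(ℂ, E) φ q :=
      ((contMDiffOn_of_mem_maximalAtlas hφ).contMDiffAt
        (φ.open_source.mem_nhds hq.1)).mdifferentiableAt (by simp)
    exact (MDifferentiableAt.comp (g := g) q h1 h2).mdifferentiableWithinAt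
  · intro q hq
    have hqφ := hq.1.2
    obtain ⟨hqe, hqO⟩ := hW hq.1.1
    have hqτ := hτs q hqφ hqe
    have h1 : HasFDerivAt (ρ ∘ τ) ((fderiv ℝ ρ (e q)).comp
        ((fderiv ℂ τ (φ q)).restrictScalars ℝ)) (φ q) := by
      refine HasFDerivAt.comp (g := ρ) (φ q) ?_ ((hτd _ hqτ).hasFDerivAt.restrictScalars ℝ)
      rw [hτe q hqφ]
      exact (hρ _ hqO).hasFDerivAt
    have h2 : (ρ ∘ e) ∘ φ.symm = ρ ∘ τ := rfl
    rw [dz, h2, h1.fderiv, part10_comp, h q hq.1.1]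
    simp only [g, Function.comp_apply, hτe q hqφ]

end RealStructure

end

end CRGeom

theorem theorem4p6 {n k m : ℕ} {X : Type*} [TopologicalSpace X]
    [ChartedSpace (EuclideanSpace ℂ (Fin (n + k))) X]
    [IsManifold 𝓘(ℂ, EuclideanSpace ℂ (Fin (n + k))) ∞ X]
    (M : Set X) (hM : CRGeom.IsGenericCR (EuclideanSpace ℂ (Fin (n + k))) k M)
    (x₀ : X) (hx₀ : x₀ ∈ M)
    (ξ₀ : CRGeom.Cotangent (EuclideanSpace ℂ (Fin (n + k))) x₀)
    (hξ₀ : CRGeom.IsRegularPoint M x₀ ξ₀)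
    (hm : CRGeom.LeviRankEq n M x₀ ξ₀ m) :
    ∃ (ω' W : Set X) (ρ : X → ℝ),
      IsOpen ω' ∧ x₀ ∈ ω' ∧
      ω' ⊆ (chartAt (EuclideanSpace ℂ (Fin (n + k))) x₀).source ∧
      x₀ ∈ W ∧ W ⊆ M ∩ ω' ∧
      CRGeom.IsSubmanifold ℂ (EuclideanSpace ℂ (Fin (n + k))) (n - m) W ∧
      CRGeom.SmoothOn (EuclideanSpace ℂ (Fin (n + k))) ρ ω' ∧
      (∀ x ∈ M ∩ ω', ρ x = 0) ∧
      CRGeom.DcEq ρ x₀ ξ₀ ∧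
      ∀ φ ∈ IsManifold.maximalAtlas 𝓘(ℂ, EuclideanSpace ℂ (Fin (n + k))) ∞ X,
        ∀ α : Fin (n + k),
          CRGeom.HolomorphicAlong (EuclideanSpace ℂ (Fin (n + k)))
            (CRGeom.dz φ ρ (EuclideanSpace.single α 1)) (W ∩ φ.source) := by
  set E := EuclideanSpace ℂ (Fin (n + k)) with hE
  have : IsManifold 𝓘(ℝ, E) ∞ X := CRGeom.isManifold_real_of_complex
  obtain ⟨U, r, -, h⟩ := hM.exists_isGenericDefining hx₀
  obtain ⟨H, Φ, ρ, Z, hdim, hxΦ, hΦ, hΦs, hxH, hρ, hZ, hρS, hdc, hW⟩ :=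
    h.exists_normalForm hξ₀ hm
  let e : OpenPartialHomeomorph X E := chartAt E x₀
  have he : e ∈ IsManifold.maximalAtlas 𝓘(ℂ, E) ∞ X := IsManifold.chart_mem_maximalAtlas x₀
  have hxe : x₀ ∈ e.source := mem_chart_source E x₀
  have hsrc : ∀ q, q ∈ (e ≫ₕ Φ).source ↔ q ∈ e.source ∧ e q ∈ Φ.source := fun q => by
    rw [OpenPartialHomeomorph.trans_source]; rfl
  have hρ' : CRGeom.SmoothOn E (ρ ∘ e) (e ≫ₕ Φ).source :=
    (contMDiffOn_iff_contDiffOn.2 hρ).comp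
      ((contMDiffOn_chart (I := 𝓘(ℝ, E)) (x := x₀)).mono fun q hq => ((hsrc q).1 hq).1)
      fun q hq => ((hsrc q).1 hq).2
  have hx₀s : x₀ ∈ (e ≫ₕ Φ).source := (hsrc x₀).2 ⟨hxe, hxΦ⟩
  refine ⟨(e ≫ₕ Φ).source, {q | q ∈ (e ≫ₕ Φ).source ∧ Φ (e q) ∈ H}, ρ ∘ e,
    (e ≫ₕ Φ).open_source, hx₀s, fun q hq => ((hsrc q).1 hq).1, ⟨hx₀s, hxH⟩, ?_, ?_, hρ', ?_, ?_, ?_⟩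
  · rintro q ⟨hq, hqH⟩
    obtain ⟨q', ⟨hq'M, hq'e⟩, hqq'⟩ := (hW _ ((hsrc q).1 hq).2 hqH).1
    rw [← e.injOn hq'e ((hsrc q).1 hq).1 hqq']
    refine ⟨hq'M, ?_⟩
    rwa [e.injOn hq'e ((hsrc q).1 hq).1 hqq']
  · rintro p ⟨hp, -⟩
    exact ⟨e ≫ₕ Φ, CRGeom.trans_mem_maximalAtlas he hΦ hΦs, hp, H, hdim,
      fun q hq => ⟨fun h => h.2, fun h => ⟨hq, h⟩⟩⟩
  · rintro q ⟨hqM, hq⟩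
    exact hρS _ ((hsrc q).1 hq).2 ⟨q, ⟨hqM, ((hsrc q).1 hq).1⟩, rfl⟩
  · intro v
    have h1 : MDifferentiableAt 𝓘(ℝ, E) 𝓘(ℝ, ℝ) (ρ ∘ e) x₀ :=
      (hρ'.contMDiffAt ((e ≫ₕ Φ).open_source.mem_nhds hx₀s)).mdifferentiableAt (by simp)
    have h2 : (ρ ∘ e) ∘ e.symm =ᶠ[𝓝 (e x₀)] ρ := by
      filter_upwards [e.open_target.mem_nhds (e.map_source hxe)] with y hy
      simp [e.right_inv hy]
    have h3 : (CRGeom.dR E (ρ ∘ e) x₀ : E →L[ℝ] ℝ) = fderiv ℝ ρ (e x₀) :=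
      (CRGeom.dR_eq_fderiv h1).trans h2.fderiv_eq
    rw [show CRGeom.dc (E := E) (CRGeom.dR E (ρ ∘ e) x₀) v = CRGeom.dc (fderiv ℝ ρ (e x₀)) v from
      congrArg (fun l : E →L[ℝ] ℝ => CRGeom.dc l v) h3]
    exact hdc v
  · intro φ hφ α
    refine CRGeom.holomorphicAlong_dz he hφ Φ.open_source (fun q hq => (hsrc q).1 hq.1)
      (fun y hy => (hρ.contDiffAt (Φ.open_source.mem_nhds hy)).differentiableAt (by simp)) hZ
      (fun q hq v => (hW _ ((hsrc q).1 hq.1).2 hq.2).2 v) _
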